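/- **Theorem.** Let $\mathsf M=(E,\operatorname{rk})$ be a loopless polymatroid: $E$ is a finite set, and $\operatorname{rk}\colon 2^E\to\mathbb Z_{\ge 0}$ is monotone and submodular with $\operatorname{rk}(\varnothing)=0$. A flat is a set $F\subseteq E$ with $\operatorname{rk}(F\cup\{e\})>\operatorname{rk}(F)$ for all $e\in E\setminus F$; loopless means that $\varnothing$ is a flat. Let $\mathcal L(\mathsf M)$ be the lattice of flats, ordered by inclusion. For a set $\mathcal G$ of flats, let $f(\mathcal G)$ be the set of its maximal elements and $\mathcal G_{\le F}=\mathcal G|_F=\{G\in\mathcal G: G\subseteq F\}$. Let $\mathcal G\subseteq\mathcal L(\mathsf M)\setminus\{\varnothing\}$ be a building set, i.e. for every flat $F$ the join map $\prod_{G\in f(\mathcal G_{\le F})}[\varnothing,G]\to[\varnothing,F]$ is an isomorphism of lattices and $\operatorname{rk}(F)=\sum_{G\in f(\mathcal G_{\le F})}\operatorname{rk}(G)$. (The ground set $E$ need not belong to $\mathcal G$.) For flats $F\subseteq G$ let $\mathsf M|_G/F$ be the polymatroid on $G\setminus F$ with rank function $A\mapsto \operatorname{rk}(A\cup F)-\operatorname{rk}(F)$;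 its lattice of flats is identified with $[F,G]$ by $H\setminus F\leftrightarrow H$. Let $\mathcal G|_G/F=\{H\vee F: H\in\mathcal G,\ H\subseteq G,\ H\not\subseteq F\}$. For a polymatroid $\mathsf M$ and a set $\mathcal G$ as above, let $$D(\mathsf M,\mathcal G)=\mathbb Q[x_G:G\in\mathcal G]\Big/\Big\langle \prod_{H\in S}x_{H}\cdot\Big(\sum_{H\in\mathcal G,\,H\supseteq G}x_H\Big)^{b}\;:\;S\subseteq\mathcal G,\ G\in\mathcal G\Big\rangle,\qquad b=\operatorname{rk}(G)-\operatorname{rk}\Big(\bigvee_{G'\in S,\ G'\subsetneq G}G'\Big),$$ graded by degree. For $E\neq\varnothing$ let $\mathrm H^{\mathcal G}_{\mathsf M}(x)=\sum_{i=0}^{\operatorname{rk}(E)-1}\dim_{\mathbb Q}D^i(\mathsf M,\mathcal G)\,x^i$. Let $\chi_{\mathsf M}(x)=\sum_{F}\mu(\varnothing,F)\,x^{\operatorname{rk}(E)-\operatorname{rk}(F)}$, the sum over all flats $F$ of $\mathsf M$, where $\mu$ is the Möbius function of $\mathcal L(\mathsf M)$, and for $E\ne\varnothing$ let $\overline\chi^{\mathcal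 G}_{\mathsf M}(x)=-\chi_{\mathsf M}(x)/(1-x)^{|f(\mathcal G)|}$. Let $\mathcal I$ be the incidence algebra of $\mathcal L(\mathsf M)$ over $\mathbb Z[x]$, with product $(a\cdot b)_{FG}=\sum_{H\in[F,G]}a_{FH}b_{HG}$. The $\mathcal G$-Chow function $\mathrm H^{\mathcal G}$ and the $\mathcal G$-reduced characteristic function $\overline\chi^{\mathcal G}$ are the elements of $\mathcal I$ with $$\mathrm H^{\mathcal G}_{FG}=\mathrm H^{\mathcal G|_G/F}_{\mathsf M|_G/F}(x),\qquad \overline\chi^{\mathcal G}_{FG}=\overline\chi^{\mathcal G|_G/F}_{\mathsf M|_G/F}(x)\qquad(F\subsetneq G),$$ and $\mathrm H^{\mathcal G}_{FF}=1$, $\overline\chi^{\mathcal G}_{FF}=-1$. These are well defined: for all flats $F\subsetneq G$ the polynomial $\chi_{\mathsf M|_G/F}(x)$ is divisible by $(1-x)^{|f(\mathcal G|_G/F)|}$ in $\mathbb Z[x]$, and $D^i(\mathsf M|_G/F,\mathcal G|_G/F)=0$ for all $i\ge\operatorname{rk}(G)-\operatorname{rk}(F)$, so that $\mathrm H^{\mathcal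 G}_{FG}$ is the whole Hilbert series. Moreover, $\overline\chi^{\mathcal G}$ is invertible in $\mathcal I$, and $$\mathrm H^{\mathcal G}=-\big(\overline\chi^{\mathcal G}\big)^{-1}.$$ -/

import Mathlib

/-- A polymatroid: a finite ground set `E` and a rank function on the subsets of `E` that is
normalized, monotone and submodular. (Values of `rk` off the subsets of `E` play no role.) -/
structure Polymatroid (α : Type*) [DecidableEq α] where
  E : Finset α
  rk : Finset α → ℕ
  rk_empty : rk ∅ = 0
  rk_mono : ∀ A B : Finset α, A ⊆ B → B ⊆ E → rk A ≤ rk B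
  rk_submod : ∀ A B : Finset α, A ⊆ E → B ⊆ E → rk (A ∪ B) + rk (A ∩ B) ≤ rk A + rk B

namespace Polymatroid

variable {α : Type*} [DecidableEq α]

/-- `F ⊆ E` is a flat if adding any further element of `E` raises the rank. -/
def IsFlat (M : Polymatroid α) (F : Finset α) : Prop :=
  F ⊆ M.E ∧ ∀ e ∈ M.E \ F, M.rk F < M.rk (insert e F)

instance (M : Polymatroid α) : DecidablePred M.IsFlat := fun F =>
  inferInstanceAs (Decidable (F ⊆ M.E ∧ ∀ e ∈ M.E \ F, M.rk F < M.rk (insert e F)))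

/-- The poset (lattice) `L(M)` of flats, ordered by inclusion. -/
abbrev Flat (M : Polymatroid α) : Type _ := {F : Finset α // M.IsFlat F}

instance (M : Polymatroid α) : Fintype M.Flat :=
  Fintype.subtype (M.E.powerset.filter M.IsFlat) fun F => by
    simp only [Finset.mem_filter, Finset.mem_powerset, and_iff_right_iff_imp]
    exact fun h => h.1

/-- `M` is loopless if the empty set is a flat. -/
def Loopless (M : Polymatroid α) : Prop := M.IsFlat ∅

/-- The closure of a subset `A` of the ground set. -/
def closure (M : Polymatroid α) (A : Finset α) : Finset α :=
  M.E.filter fun e => M.rk (insert e A) = M.rk A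

theorem subset_closure (M : Polymatroid α) {A : Finset α} (hA : A ⊆ M.E) :
    A ⊆ M.closure A := fun e he => by
  simp [closure, hA he, Finset.insert_eq_of_mem he]

theorem closure_subset_ground (M : Polymatroid α) (A : Finset α) : M.closure A ⊆ M.E :=
  Finset.filter_subset _ _

theorem rk_union_of_subset_closure (M : Polymatroid α) {A B : Finset α} (hA : A ⊆ M.E)
    (hB : B ⊆ M.closure A) : M.rk (A ∪ B) = M.rk A := by
  induction B using Finset.induction_on with
  | empty => simp
  | insert b B hb ih =>
    have hB' : B ⊆ M.closure A := fun x hx => hB (Finset.mem_insert_of_mem hx)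
    have hBE : B ⊆ M.E := hB'.trans (M.closure_subset_ground A)
    have hbc : b ∈ M.closure A := hB (Finset.mem_insert_self _ _)
    have hbE : b ∈ M.E := M.closure_subset_ground A hbc
    have hb1 : M.rk (insert b A) = M.rk A := (Finset.mem_filter.1 hbc).2
    have h1 := M.rk_submod (A ∪ B) (insert b A) (Finset.union_subset hA hBE)
      (Finset.insert_subset hbE hA)
    have h2 : (A ∪ B) ∪ insert b A = A ∪ insert b B := by
      ext x; simp only [Finset.mem_union, Finset.mem_insert]; tauto
    have h3 : M.rk A ≤ M.rk ((A ∪ B) ∩ insert b A) :=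
      M.rk_mono _ _ (fun x hx => by simp [hx])
        (Finset.inter_subset_left.trans (Finset.union_subset hA hBE))
    have h4 : M.rk A ≤ M.rk (A ∪ insert b B) :=
      M.rk_mono _ _ Finset.subset_union_left
        (Finset.union_subset hA (Finset.insert_subset hbE hBE))
    rw [h2, ih hB', hb1] at h1
    omega

theorem isFlat_closure (M : Polymatroid α) {A : Finset α} (hA : A ⊆ M.E) :
    M.IsFlat (M.closure A) := by
  refine ⟨M.closure_subset_ground A, fun e he => ?_⟩
  obtain ⟨heE, hec⟩ := Finset.mem_sdiff.1 he
  have hrk : M.rk (M.closure A) = M.rk A := by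
    have := M.rk_union_of_subset_closure hA (Finset.Subset.refl (M.closure A))
    rwa [Finset.union_eq_right.2 (M.subset_closure hA)] at this
  have h1 : M.rk A ≤ M.rk (insert e A) :=
    M.rk_mono _ _ (Finset.subset_insert _ _) (Finset.insert_subset heE hA)
  have h2 : M.rk (insert e A) ≠ M.rk A := fun h => hec (Finset.mem_filter.2 ⟨heE, h⟩)
  have h3 : M.rk (insert e A) ≤ M.rk (insert e (M.closure A)) :=
    M.rk_mono _ _ (Finset.insert_subset_insert _ (M.subset_closure hA))
      (Finset.insert_subset heE (M.closure_subset_ground A))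
  omega

theorem closure_subset_of_isFlat (M : Polymatroid α) {A F : Finset α} (hF : M.IsFlat F)
    (hAF : A ⊆ F) : M.closure A ⊆ F := by
  intro e he
  obtain ⟨heE, hrk⟩ := Finset.mem_filter.1 he
  by_contra heF
  have h1 := hF.2 e (Finset.mem_sdiff.2 ⟨heE, heF⟩)
  have h2 := M.rk_submod (insert e A) F (Finset.insert_subset heE (hAF.trans hF.1)) hF.1
  have h3 : insert e A ∪ F = insert e F := by
    rw [Finset.insert_union, Finset.union_eq_right.2 hAF]
  have h4 : insert e A ∩ F = A := by
    rw [Finset.insert_inter_of_notMem heF, Finset.inter_eq_left.2 hAF]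
  rw [h3, h4, hrk] at h2
  omega

/-- The join, in the lattice of flats, of a finite family of sets `S i`: the closure of their
union. -/
def join (M : Polymatroid α) {ι : Type*} (T : Finset ι) (S : ι → Finset α) : Finset α :=
  M.closure (T.sup S)

/-- `join` of a family of flats is its least upper bound in the lattice of flats. -/
theorem join_isLUB (M : Polymatroid α) {ι : Type*} (T : Finset ι) (S : ι → M.Flat) :
    ∃ h : M.IsFlat (M.join T fun i => (S i).1),
      IsLUB (S '' (T : Set ι)) (⟨M.join T fun i => (S i).1, h⟩ : M.Flat) := by
  have hE : (T.sup fun i => (S i).1) ⊆ M.E := Finset.sup_le fun i _ => (S i).2.1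
  refine ⟨M.isFlat_closure hE, ?_, ?_⟩
  · rintro _ ⟨i, hi, rfl⟩
    exact (Finset.le_sup (f := fun i => (S i).1) hi).trans (M.subset_closure hE)
  · intro F hF
    exact M.closure_subset_of_isFlat F.2 (Finset.sup_le fun i hi => hF ⟨i, hi, rfl⟩)

/-- The restriction `M|_F`. -/
def restrict (M : Polymatroid α) (F : Finset α) (hF : F ⊆ M.E) : Polymatroid α where
  E := F
  rk := M.rk
  rk_empty := M.rk_empty
  rk_mono A B h hB := M.rk_mono A B h (hB.trans hF)
  rk_submod A B hA hB := M.rk_submod A B (hA.trans hF) (hB.trans hF)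

/-- The contraction `M/F`, on the ground set `E \ F`, with rank `A ↦ rk (A ∪ F) - rk F`. -/
def contract (M : Polymatroid α) (F : Finset α) (hF : F ⊆ M.E) : Polymatroid α where
  E := M.E \ F
  rk A := M.rk (A ∪ F) - M.rk F
  rk_empty := by simp
  rk_mono A B h hB := Nat.sub_le_sub_right
    (M.rk_mono _ _ (Finset.union_subset_union_left h)
      (Finset.union_subset (hB.trans Finset.sdiff_subset) hF)) _
  rk_submod A B hA hB := by
    have hA' : A ∪ F ⊆ M.E := Finset.union_subset (hA.trans Finset.sdiff_subset) hF
    have hB' : B ∪ F ⊆ M.E := Finset.union_subset (hB.trans Finset.sdiff_subset) hF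
    have h := M.rk_submod (A ∪ F) (B ∪ F) hA' hB'
    rw [← Finset.union_union_distrib_right, ← Finset.inter_union_distrib_right] at h
    have h1 : M.rk F ≤ M.rk (A ∩ B ∪ F) := M.rk_mono _ _ Finset.subset_union_right
      (Finset.union_subset (Finset.inter_subset_left.trans (hA.trans Finset.sdiff_subset)) hF)
    have h2 : M.rk F ≤ M.rk (A ∪ F) := M.rk_mono _ _ Finset.subset_union_right hA'
    have h3 : M.rk F ≤ M.rk (B ∪ F) := M.rk_mono _ _ Finset.subset_union_right hB'
    have h4 : M.rk F ≤ M.rk (A ∪ B ∪ F) := M.rk_mono _ _ Finset.subset_union_right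
      (Finset.union_subset (Finset.union_subset (hA.trans Finset.sdiff_subset)
        (hB.trans Finset.sdiff_subset)) hF)
    omega

/-- The minor `(M|_G)/F` for flats `F ≤ G`. -/
def minor (M : Polymatroid α) (F G : M.Flat) (h : F ≤ G) : Polymatroid α :=
  (M.restrict G.1 G.2.1).contract F.1 h

/-! ### Building sets -/

/-- The members of `𝒢` contained in `F`, i.e. `𝒢_{≤ F} = 𝒢|_F`. -/
def below (𝒢 : Finset (Finset α)) (F : Finset α) : Finset (Finset α) := 𝒢.filter (· ⊆ F)

/-- The inclusion-maximal members of `𝒢` (the `𝒢`-factors). -/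
def factors (𝒢 : Finset (Finset α)) : Finset (Finset α) :=
  𝒢.filter fun G => ∀ H ∈ 𝒢, G ⊆ H → H = G

/-- `𝒢` is a building set on the lattice of flats of `M`: it consists of nonempty flats, and for
each flat `F` the join map `∏_{G ∈ f(𝒢_{≤ F})} [∅, G] → [∅, F]` is an isomorphism and the ranks
of the factors of `F` add up to the rank of `F`. -/
structure IsBuildingSet (M : Polymatroid α) (𝒢 : Finset (Finset α)) : Prop where
  isFlat : ∀ G ∈ 𝒢, M.IsFlat G
  nonempty : ∀ G ∈ 𝒢, G.Nonempty
  iso : ∀ F : M.Flat,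
    ∃ φ : ((G : {G // G ∈ factors (below 𝒢 F.1)}) → {H : M.Flat // H.1 ⊆ G.1}) ≃o
        {H : M.Flat // H ≤ F},
      ∀ x, (φ x).1.1 = M.join Finset.univ fun G => (x G).1.1
  rk_eq : ∀ F : M.Flat, M.rk F.1 = ∑ G ∈ factors (below 𝒢 F.1), M.rk G

/-- The set `𝒢/F = {G ∨ F : G ∈ 𝒢, G ⊄ F}`; a flat `H ⊇ F` of `M` corresponds to the flat
`H \ F` of `M/F`. -/
def contractSet (M : Polymatroid α) (𝒢 : Finset (Finset α)) (F : Finset α) :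
    Finset (Finset α) :=
  (𝒢.filter fun G => ¬ G ⊆ F).image fun G => M.closure (G ∪ F) \ F

/-- The set `𝒢|_G/F` on the minor `(M|_G)/F`. -/
def minorSet (M : Polymatroid α) (𝒢 : Finset (Finset α)) (F G : M.Flat) : Finset (Finset α) :=
  (M.restrict G.1 G.2.1).contractSet (below 𝒢 G.1) F.1

/-! ### The Chow ring -/

/-- The relation attached to `S ⊆ 𝒢` and `G ∈ 𝒢`. -/
noncomputable def chowRelation (M : Polymatroid α) (𝒢 : Finset (Finset α))
    (S : Finset {G // G ∈ 𝒢}) (G : {G // G ∈ 𝒢}) : MvPolynomial {G // G ∈ 𝒢} ℚ :=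
  (∏ H ∈ S, MvPolynomial.X H) *
    (∑ H : {G // G ∈ 𝒢} with G.1 ⊆ H.1, MvPolynomial.X H) ^
      (M.rk G.1 - M.rk (M.join (S.filter fun H => H.1 ⊂ G.1) Subtype.val))

/-- The defining ideal of the Chow ring, generated by all the relations. -/
noncomputable def chowIdeal (M : Polymatroid α) (𝒢 : Finset (Finset α)) :
    Ideal (MvPolynomial {G // G ∈ 𝒢} ℚ) :=
  Ideal.span {p | ∃ S G, p = M.chowRelation 𝒢 S G}

/-- The Chow ring `D(M, 𝒢)`. -/
abbrev ChowRing (M : Polymatroid α) (𝒢 : Finset (Finset α)) : Type _ :=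
  MvPolynomial {G // G ∈ 𝒢} ℚ ⧸ M.chowIdeal 𝒢

/-- The degree `i` part `D^i(M, 𝒢)`: the image of the homogeneous polynomials of degree `i`. -/
noncomputable def chowPiece (M : Polymatroid α) (𝒢 : Finset (Finset α)) (i : ℕ) :
    Submodule ℚ (M.ChowRing 𝒢) :=
  (MvPolynomial.homogeneousSubmodule {G // G ∈ 𝒢} ℚ i).map
    (Ideal.Quotient.mkₐ ℚ (M.chowIdeal 𝒢)).toLinearMap

/-- The `𝒢`-Chow polynomial: the Hilbert series of `D(M, 𝒢)`, which lives in degrees below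
`rk E`; it is `1` for the empty polymatroid. -/
noncomputable def chowPoly (M : Polymatroid α) (𝒢 : Finset (Finset α)) : Polynomial ℤ :=
  if M.E = ∅ then 1
  else ∑ i ∈ Finset.range (M.rk M.E),
    Polynomial.monomial i (Module.finrank ℚ (M.chowPiece 𝒢 i) : ℤ)

/-! ### Characteristic polynomials -/

/-- The least flat (the empty set if `M` is loopless). -/
def botFlat (M : Polymatroid α) : M.Flat :=
  ⟨M.closure ∅, M.isFlat_closure (Finset.empty_subset _)⟩

/-- The characteristic polynomial `∑_F μ(∅, F) x^(rk E - rk F)`. -/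
noncomputable def charPoly (M : Polymatroid α) : Polynomial ℤ :=
  ∑ F : M.Flat, Polynomial.monomial (M.rk M.E - M.rk F.1)
    (IncidenceAlgebra.mu ℤ M.botFlat F)

/-- The `𝒢`-reduced characteristic polynomial: `-1` for the empty polymatroid, and otherwise
`-χ_M(x) / (1 - x)^k` with `k` the number of `𝒢`-factors, written as
`-(-1)^k (χ_M(x) / (x - 1)^k)` with the division of polynomials by a monic polynomial. -/
noncomputable def reducedCharPoly (M : Polymatroid α) (𝒢 : Finset (Finset α)) :
    Polynomial ℤ :=
  if M.E = ∅ then -1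
  else -((-1) ^ (factors 𝒢).card *
    (M.charPoly /ₘ (Polynomial.X - 1) ^ (factors 𝒢).card))

/-! ### Elements of the incidence algebra -/

/-- The `𝒢`-Chow function. -/
noncomputable def chowFun (M : Polymatroid α) (𝒢 : Finset (Finset α)) :
    IncidenceAlgebra (Polynomial ℤ) M.Flat where
  toFun F G :=
    if h : F < G then (M.minor F G h.le).chowPoly (M.minorSet 𝒢 F G)
    else if F = G then 1 else 0
  eq_zero_of_not_le' F G h := by
    rw [dif_neg fun h' => h h'.le, if_neg fun h' => h h'.le]

/-- The `𝒢`-reduced characteristic function. -/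
noncomputable def reducedCharFun (M : Polymatroid α) (𝒢 : Finset (Finset α)) :
    IncidenceAlgebra (Polynomial ℤ) M.Flat where
  toFun F G :=
    if h : F < G then (M.minor F G h.le).reducedCharPoly (M.minorSet 𝒢 F G)
    else if F = G then -1 else 0
  eq_zero_of_not_le' F G h := by
    rw [dif_neg fun h' => h h'.le, if_neg fun h' => h h'.le]

end Polymatroid

/-! The proof computes the Hilbert series of every Chow ring by an explicit basis, and then the
identity becomes a count of exponents. Everything is first done for an abstract family `g : ι ↪o L`
in a ranked lattice. Rank additivity and submodularity make the interval below any admissible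
element a product over its factors. The same axioms hold for joins above a fixed element
(`IsBuilding.contract`), so one abstract argument covers all minors.

Call an exponent `a` standard if `a i + r (subJoin g a i) < r (g i)` for all `i`. The vectors
`stdVec a`, in which one copy of each variable of the support is kept and the others are replaced by
`upVar`, form a basis of the quotient. They span because, with `X i` weighted by `r (g i)`, each
nonstandard monomial is the lightest term of an element of the ideal (`IsBuilding.monomial_mem`).

For independence, change variables by Möbius inversion so that `upVar i` becomes `X i`. The
functional `ell` detects the monomials whose total below every member is smaller than its rank.
Members where a total equals the rank (tight members) are closed under joins by uncrossing. This
evaluates `ell` on products of dual variables up to sign (`IsBuilding.ell_monomial_mul_prod`) and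
shows that it kills the relations. Pairing `stdVec a` with the dual exponent of `b` is then
triangular for a lexicographic order (`IsBuilding.stdVec_independent`).

For the convolution identity, split one factor `m` off `t`, and fix the component `y` in the
remaining factors. Interchanging sums, a standard exponent `a` contributes `X` to the power its
degree plus `r (g m)` minus the rank of the join of its support under `m`. The correction vanishes
if `a m ≠ 0` and is the length of the allowed range of `a m` otherwise. Rotating `a m` cyclically in
that range turns the total into `X` times the original series (`sum_stdBelow_top`). The term `x = g
m` has one power of `1 - X` fewer in its denominator, and this cancels exactly that multiple. Hence
`-H` is a left inverse, and finiteness of the poset makes it two-sided. -/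

set_option linter.unusedSectionVars false

/-! ### Building sets in a ranked lattice and their product decompositions -/

namespace BuildingSet

open scoped Classical in
/-- The indices of the maximal members of the family `g` below `F`. -/
noncomputable def fac {ι L : Type*} [Fintype ι] [PartialOrder ι] [Lattice L]
    (g : ι ↪o L) (F : L) : Finset ι :=
  Finset.univ.filter fun i => g i ≤ F ∧ ∀ j, g j ≤ F → i ≤ j → j = i

/-- A rank function on a lattice: normalized, strictly monotone and submodular. -/
structure IsRank {L : Type*} [Lattice L] [OrderBot L] (r : L → ℕ) : Prop where
  bot : r ⊥ = 0
  strictMono : StrictMono r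
  submod : ∀ a b, r (a ⊔ b) + r (a ⊓ b) ≤ r a + r b

/-- The family `g` is a building set for the elements below `t` of a ranked lattice. -/
structure IsBuilding {ι L : Type*} [Fintype ι] [PartialOrder ι] [Lattice L] [OrderBot L]
    (g : ι ↪o L) (r : L → ℕ) (t : L) : Prop extends IsRank r where
  ne_bot : ∀ i, g i ≠ ⊥
  decomp : ∀ F ≤ t, ∀ K ≤ F, K ≤ (fac g F).sup fun i => K ⊓ g i
  rk_eq : ∀ F ≤ t, r F = ∑ i ∈ fac g F, r (g i)

section Lattice

open scoped Classical

variable {ι L : Type*} [Fintype ι] [PartialOrder ι] [Lattice L]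
  {g : ι ↪o L}

theorem mem_fac {F : L} {i : ι} :
    i ∈ fac g F ↔ g i ≤ F ∧ ∀ j, g j ≤ F → i ≤ j → j = i := by
  simp [fac]

theorem exists_mem_fac {F : L} {i : ι} (hi : g i ≤ F) : ∃ k ∈ fac g F, i ≤ k := by
  obtain ⟨k, hk⟩ := (Finset.univ.filter fun j => g j ≤ F ∧ i ≤ j).exists_maximal
    ⟨i, by simp [hi]⟩
  have hk1 := hk.1
  simp only [Finset.mem_filter, Finset.mem_univ, true_and] at hk1
  refine ⟨k, mem_fac.2 ⟨hk1.1, fun j hj hkj => le_antisymm (hk.2 ?_ hkj) hkj⟩, hk1.2⟩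
  simp [hj, hk1.2.trans hkj]

variable [OrderBot L] {r : L → ℕ} {t : L}

theorem IsRank.sup_le_sum (h : IsRank r) {κ : Type*} (s : Finset κ) (x : κ → L) :
    r (s.sup x) ≤ ∑ i ∈ s, r (x i) := by
  induction s using Finset.induction_on with
  | empty => simp [h.bot]
  | insert a s ha ih =>
    rw [Finset.sup_insert, Finset.sum_insert ha]
    have := h.submod (x a) (s.sup x)
    omega

/-- By submodularity, enlarging one joinand raises the rank of a join by at most the increase in the
rank of that joinand. Additivity of the rank at the factors themselves is passed down to smaller
components this way. -/
theorem IsRank.sup_add_sum_le (h : IsRank r) {κ : Type*} (s : Finset κ) (x z : κ → L)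
    (hxz : ∀ i ∈ s, x i ≤ z i) (y : L) :
    r (y ⊔ s.sup z) + ∑ i ∈ s, r (x i) ≤ r (y ⊔ s.sup x) + ∑ i ∈ s, r (z i) := by
  induction s using Finset.induction_on generalizing y with
  | empty => simp
  | insert a s ha ih =>
    rw [Finset.sup_insert, Finset.sum_insert ha, Finset.sup_insert, Finset.sum_insert ha]
    have h1 := ih (fun i hi => hxz i (Finset.mem_insert_of_mem hi)) (y ⊔ z a)
    have h2 := h.submod (y ⊔ x a ⊔ s.sup x) (z a)
    have hxa := hxz a (Finset.mem_insert_self _ _)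
    have h3 : y ⊔ x a ⊔ s.sup x ⊔ z a = y ⊔ z a ⊔ s.sup x := by
      apply le_antisymm
      · refine sup_le (sup_le (sup_le ?_ ?_) ?_) ?_
        · exact le_sup_of_le_left le_sup_left
        · exact le_sup_of_le_left (le_sup_of_le_right hxa)
        · exact le_sup_right
        · exact le_sup_of_le_left le_sup_right
      · refine sup_le (sup_le ?_ le_sup_right) ?_
        · exact le_sup_of_le_left (le_sup_of_le_left le_sup_left)
        · exact le_sup_of_le_left le_sup_right
    have h4 : r (x a) ≤ r ((y ⊔ x a ⊔ s.sup x) ⊓ z a) :=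
      h.strictMono.monotone (le_inf (le_sup_of_le_left le_sup_right) hxa)
    rw [h3] at h2
    rw [← sup_assoc, ← sup_assoc]
    omega

theorem IsBuilding.mono {t' : L} (h : IsBuilding g r t) (ht : t' ≤ t) : IsBuilding g r t' where
  toIsRank := h.toIsRank
  ne_bot := h.ne_bot
  decomp F hF := h.decomp F (hF.trans ht)
  rk_eq F hF := h.rk_eq F (hF.trans ht)

theorem IsBuilding.sup_fac (h : IsBuilding g r t) {F : L} (hF : F ≤ t) :
    (fac g F).sup g = F := by
  apply le_antisymm
  · exact Finset.sup_le fun i hi => (mem_fac.1 hi).1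
  · exact (h.decomp F hF F le_rfl).trans (Finset.sup_mono_fun fun i _ => inf_le_right)

theorem IsBuilding.sup_inf (h : IsBuilding g r t) {F K : L} (hF : F ≤ t) (hK : K ≤ F) :
    ((fac g F).sup fun i => K ⊓ g i) = K :=
  le_antisymm (Finset.sup_le fun _ _ => inf_le_left) (h.decomp F hF K hK)

/-- The rank is additive on families subordinate to the factors. -/
theorem IsBuilding.rk_sup (h : IsBuilding g r t) {F : L} (hF : F ≤ t) (x : ι → L)
    (hx : ∀ i ∈ fac g F, x i ≤ g i) :
    r ((fac g F).sup x) = ∑ i ∈ fac g F, r (x i) := by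
  apply le_antisymm (h.sup_le_sum _ _)
  have := h.sup_add_sum_le (fac g F) x g hx ⊥
  rw [bot_sup_eq, bot_sup_eq, h.sup_fac hF, ← h.rk_eq F hF] at this
  omega

/-- This is injectivity of the join map, obtained from ranks alone. If the component at `k` were
larger than `x k`, substituting it would leave the join below `s` while the additive rank strictly
grew. -/
theorem IsBuilding.sup_inf_eq (h : IsBuilding g r t) {F : L} (hF : F ≤ t) (x : ι → L)
    (hx : ∀ i ∈ fac g F, x i ≤ g i) {k : ι} (hk : k ∈ fac g F) :
    (fac g F).sup x ⊓ g k = x k := by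
  set s := (fac g F).sup x with hs
  have hle : x k ≤ s ⊓ g k := le_inf (Finset.le_sup (f := x) hk) (hx k hk)
  by_contra hne
  have hlt := h.strictMono (lt_of_le_of_ne hle (Ne.symm hne))
  have h1 := h.rk_sup hF (Function.update x k (s ⊓ g k)) fun i hi => by
    by_cases hik : i = k
    · subst hik; simp
    · simp [hik, hx i hi]
  have h2 : (fac g F).sup (Function.update x k (s ⊓ g k)) ≤ s := Finset.sup_le fun i hi => by
    by_cases hik : i = k
    · subst hik; simp
    · simpa [hik] using Finset.le_sup (f := x) hi
  have h3 := h.strictMono.monotone h2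
  rw [h1, h.rk_sup hF x hx] at h3
  have h4 : ∑ i ∈ fac g F, r (x i) < ∑ i ∈ fac g F, r (Function.update x k (s ⊓ g k) i) := by
    apply Finset.sum_lt_sum
    · intro i hi
      by_cases hik : i = k
      · subst hik; simpa using hlt.le
      · simp [hik]
    · exact ⟨k, hk, by simpa using hlt⟩
  omega

theorem IsBuilding.fac_disjoint (h : IsBuilding g r t) {F : L} (hF : F ≤ t) {i j : ι}
    (hi : i ∈ fac g F) (hj : j ∈ fac g F) (hij : i ≠ j) : g i ⊓ g j = ⊥ := by
  have := h.sup_inf_eq hF (fun k => if k = i then g i else ⊥)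
    (fun k hk => by by_cases hki : k = i <;> simp [hki]) hj
  rw [if_neg hij.symm] at this
  rw [← le_bot_iff, ← this]
  refine inf_le_inf_right _ ?_
  have := Finset.le_sup (f := fun k => if k = i then g i else ⊥) hi
  simpa using this

theorem IsBuilding.fac_unique (h : IsBuilding g r t) {F : L} (hF : F ≤ t) {i j k : ι}
    (hi : i ∈ fac g F) (hj : j ∈ fac g F) (hki : k ≤ i) (hkj : k ≤ j) : i = j := by
  by_contra hij
  have := h.fac_disjoint hF hi hj hij
  exact h.ne_bot k (le_bot_iff.1 (this ▸ le_inf (g.le_iff_le.2 hki) (g.le_iff_le.2 hkj)))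

/-- Distinct factors of the join are disjoint, so a common lower member forces both members under
one factor, which is then the whole join. -/
theorem IsBuilding.exists_sup (h : IsBuilding g r t) {i j k : ι} (hi : g i ≤ t) (hj : g j ≤ t)
    (hki : k ≤ i) (hkj : k ≤ j) : ∃ l, g l = g i ⊔ g j := by
  have hF : g i ⊔ g j ≤ t := sup_le hi hj
  obtain ⟨a, ha, hia⟩ := exists_mem_fac (g := g) (le_sup_left : g i ≤ g i ⊔ g j)
  obtain ⟨b, hb, hjb⟩ := exists_mem_fac (g := g) (le_sup_right : g j ≤ g i ⊔ g j)
  obtain rfl := h.fac_unique hF ha hb (hki.trans hia) (hkj.trans hjb)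
  exact ⟨a, le_antisymm (mem_fac.1 ha).1 (sup_le (g.le_iff_le.2 hia) (g.le_iff_le.2 hjb))⟩

/-- Sums over the members below `F` split over the factors of `F`. -/
theorem IsBuilding.sum_le_eq (h : IsBuilding g r t) {F : L} (hF : F ≤ t) {R : Type*}
    [AddCommMonoid R] (e : ι → R) :
    ∑ j with g j ≤ F, e j = ∑ i ∈ fac g F, ∑ j with j ≤ i, e j := by
  rw [← Finset.sum_biUnion]
  · apply Finset.sum_congr _ fun _ _ => rfl
    ext j
    simp only [Finset.mem_filter, Finset.mem_univ, true_and, Finset.mem_biUnion]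
    constructor
    · exact exists_mem_fac
    · rintro ⟨i, hi, hji⟩
      exact (g.le_iff_le.2 hji).trans (mem_fac.1 hi).1
  · intro i hi j hj hij
    refine Finset.disjoint_left.2 fun k hk hk' => hij ?_
    simp only [Finset.mem_filter, Finset.mem_univ, true_and] at hk hk'
    exact h.fac_unique hF hi hj hk hk'

end Lattice

end BuildingSet

namespace BuildingSet

/-! ### Exponents bounded by ranks, tight members and Möbius inversion -/

section Tight

open scoped Classical

variable {ι L : Type*} [Fintype ι] [PartialOrder ι] [Lattice L] [OrderBot L]
  {g : ι ↪o L} {r : L → ℕ} {t : L}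

/-- The total exponent of the members below `F`. -/
noncomputable def low (g : ι ↪o L) (e : ι → ℕ) (F : L) : ℕ := ∑ j with g j ≤ F, e j

theorem low_apply (e : ι → ℕ) (i : ι) : low g e (g i) = ∑ j with j ≤ i, e j := by
  simp [low]

theorem low_add (e e' : ι → ℕ) (F : L) : low g (e + e') F = low g e F + low g e' F := by
  simp [low, Finset.sum_add_distrib]

theorem low_single (k : ι) (n : ℕ) (F : L) :
    low g (Pi.single k n) F = if g k ≤ F then n else 0 := by
  simp [low, Pi.single_apply, Finset.sum_ite_eq']

theorem low_supermod (e : ι → ℕ) (F F' : L) :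
    low g e F + low g e F' ≤ low g e (F ⊔ F') + low g e (F ⊓ F') := by
  unfold low
  rw [← Finset.sum_union_inter]
  refine add_le_add (Finset.sum_le_sum_of_subset ?_) (Finset.sum_le_sum_of_subset ?_)
  · intro j hj
    simp only [Finset.mem_union, Finset.mem_filter, Finset.mem_univ, true_and] at hj ⊢
    rcases hj with hj | hj
    · exact le_sup_of_le_left hj
    · exact le_sup_of_le_right hj
  · intro j hj
    simp only [Finset.mem_inter, Finset.mem_filter, Finset.mem_univ, true_and] at hj ⊢
    exact le_inf hj.1 hj.2

theorem IsBuilding.low_eq (h : IsBuilding g r t) {F : L} (hF : F ≤ t) (e : ι → ℕ) :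
    low g e F = ∑ i ∈ fac g F, low g e (g i) := by
  simp_rw [low_apply]
  exact h.sum_le_eq hF e

/-- The exponents whose total below each member is at most the rank of that member. -/
def Capped (g : ι ↪o L) (r : L → ℕ) (e : ι → ℕ) : Prop := ∀ i, low g e (g i) ≤ r (g i)

theorem IsBuilding.low_le (h : IsBuilding g r t) {e : ι → ℕ} (he : Capped g r e) {F : L}
    (hF : F ≤ t) : low g e F ≤ r F := by
  rw [h.low_eq hF, h.rk_eq F hF]
  exact Finset.sum_le_sum fun i _ => he i

/-- Uncrossing: totals are supermodular, ranks are submodular, and totals never exceed ranks, so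
equality at two elements passes to their join. -/
theorem IsBuilding.low_sup (h : IsBuilding g r t) {e : ι → ℕ} (he : Capped g r e) {F F' : L}
    (hF : F ≤ t) (hF' : F' ≤ t) (h1 : low g e F = r F) (h2 : low g e F' = r F') :
    low g e (F ⊔ F') = r (F ⊔ F') := by
  have h3 := low_supermod (g := g) e F F'
  have h4 := h.low_le he (sup_le hF hF')
  have h5 := h.low_le he (inf_le_left.trans hF : F ⊓ F' ≤ t)
  have h6 := h.submod F F'
  omega

theorem IsBuilding.low_finset_sup (h : IsBuilding g r t) (ht : ∀ i, g i ≤ t) {e : ι → ℕ}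
    (he : Capped g r e) (T : Finset ι) (hT : ∀ i ∈ T, low g e (g i) = r (g i)) :
    low g e (T.sup g) = r (T.sup g) := by
  induction T using Finset.induction_on with
  | empty =>
    have := h.low_le he (bot_le : ⊥ ≤ t)
    simp only [Finset.sup_empty]
    rw [h.bot] at this ⊢
    omega
  | insert a T ha ih =>
    rw [Finset.sup_insert]
    exact h.low_sup he (ht a) (Finset.sup_le fun i _ => ht i)
      (hT a (Finset.mem_insert_self _ _)) (ih fun i hi => hT i (Finset.mem_insert_of_mem hi))

/-- If no member above `h` is tight, the almost tight members above `h` are closed under join. -/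
theorem IsBuilding.near_sup (hB : IsBuilding g r t) (ht : ∀ i, g i ≤ t) {e : ι → ℕ}
    (he : Capped g r e) {h : ι} (hh : ∀ k, h ≤ k → low g e (g k) ≠ r (g k)) {i j : ι}
    (hi : h ≤ i) (hj : h ≤ j) (hi' : low g e (g i) + 1 = r (g i))
    (hj' : low g e (g j) + 1 = r (g j)) :
    ∃ l, i ≤ l ∧ j ≤ l ∧ low g e (g l) + 1 = r (g l) := by
  obtain ⟨l, hl⟩ := hB.exists_sup (ht i) (ht j) hi hj
  have hil : i ≤ l := g.le_iff_le.1 (hl ▸ le_sup_left)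
  have hjl : j ≤ l := g.le_iff_le.1 (hl ▸ le_sup_right)
  refine ⟨l, hil, hjl, ?_⟩
  have h1 := low_supermod (g := g) e (g i) (g j)
  have h2 := hB.submod (g i) (g j)
  have hF : g i ⊓ g j ≤ t := inf_le_left.trans (ht i)
  -- The meet contains `g h`, so one of its factors lies above `h` and is not tight. This slack of
  -- at least one on the meet absorbs one of the two units missing at `i` and `j`.
  have h3 : low g e (g i ⊓ g j) < r (g i ⊓ g j) := by
    rw [hB.low_eq hF, hB.rk_eq _ hF]
    obtain ⟨k, hk, hhk⟩ := exists_mem_fac (g := g)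
      (le_inf (g.le_iff_le.2 hi) (g.le_iff_le.2 hj) : g h ≤ g i ⊓ g j)
    exact Finset.sum_lt_sum (fun i _ => he i) ⟨k, hk, lt_of_le_of_ne (he k) (hh k hhk)⟩
  have h4 := lt_of_le_of_ne (he l) (hh l (hi.trans hil))
  rw [← hl] at h1 h2
  omega

theorem IsBuilding.exists_near_max (hB : IsBuilding g r t) (ht : ∀ i, g i ≤ t) {e : ι → ℕ}
    (he : Capped g r e) {h : ι} (hh : ∀ k, h ≤ k → low g e (g k) ≠ r (g k))
    (hne : ∃ k, h ≤ k ∧ low g e (g k) + 1 = r (g k)) :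
    ∃ n, h ≤ n ∧ low g e (g n) + 1 = r (g n) ∧
      ∀ k, h ≤ k → low g e (g k) + 1 = r (g k) → k ≤ n := by
  obtain ⟨n, hn⟩ := (Finset.univ.filter fun k => h ≤ k ∧ low g e (g k) + 1 = r (g k)).exists_maximal
    (by obtain ⟨k, hk⟩ := hne; exact ⟨k, by simpa using hk⟩)
  have hn1 := hn.1
  simp only [Finset.mem_filter, Finset.mem_univ, true_and] at hn1
  refine ⟨n, hn1.1, hn1.2, fun k hk hk' => ?_⟩
  obtain ⟨l, hkl, hnl, hl⟩ := hB.near_sup ht he hh hk hn1.1 hk' hn1.2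
  exact hkl.trans (hn.2 (by simp [hl, hk.trans hkl]) hnl)

/-- All members above `h` lie under the same factor of `t`. Möbius sums over the whole up-set of `h`
are therefore sums over an interval. -/
theorem IsBuilding.exists_top (hB : IsBuilding g r t) (ht : ∀ i, g i ≤ t) (h : ι) :
    ∃ m, IsMax m ∧ h ≤ m ∧ ∀ k, h ≤ k → k ≤ m := by
  obtain ⟨m, hm, hhm⟩ := exists_mem_fac (ht h)
  refine ⟨m, fun k hk => ((mem_fac.1 hm).2 k (ht k) hk).le, hhm, fun k hk => ?_⟩
  obtain ⟨m', hm', hhm'⟩ := exists_mem_fac (ht k)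
  rwa [hB.fac_unique le_rfl hm hm' hhm (hk.trans hhm')]

/-- The Möbius function of the index poset. -/
noncomputable def mob (h k : ι) : ℚ :=
  letI := Fintype.toLocallyFiniteOrder (α := ι)
  IncidenceAlgebra.mu ℚ h k

theorem sum_mob_right (h k : ι) :
    ∑ j with h ≤ j ∧ j ≤ k, mob h j = if h = k then 1 else 0 := by
  let := Fintype.toLocallyFiniteOrder (α := ι)
  rw [← IncidenceAlgebra.sum_Icc_mu_right (𝕜 := ℚ) h k]
  refine Finset.sum_congr ?_ fun _ _ => rfl
  ext j; simp

theorem sum_mob_left (h k : ι) :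
    ∑ j with h ≤ j ∧ j ≤ k, mob j k = if h = k then 1 else 0 := by
  let := Fintype.toLocallyFiniteOrder (α := ι)
  rw [← IncidenceAlgebra.sum_Icc_mu_left (𝕜 := ℚ) h k]
  refine Finset.sum_congr ?_ fun _ _ => rfl
  ext j; simp

theorem IsBuilding.sum_mob (hB : IsBuilding g r t) (ht : ∀ i, g i ≤ t) (h : ι) :
    ∑ k with h ≤ k, mob h k = if IsMax h then 1 else 0 := by
  obtain ⟨m, hm, hhm, htop⟩ := hB.exists_top ht h
  have h1 := sum_mob_right h m
  have h2 : (Finset.univ.filter fun j => h ≤ j ∧ j ≤ m) = Finset.univ.filter fun j => h ≤ j := by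
    ext j
    simp only [Finset.mem_filter, Finset.mem_univ, true_and, and_iff_left_iff_imp]
    exact htop j
  rw [h2] at h1
  rw [h1]
  congr 1
  exact propext ⟨fun h => h ▸ hm, fun h => le_antisymm hhm (h hhm)⟩

/-- `e` is capped, with set of tight members `S`. -/
def TightAt (g : ι ↪o L) (r : L → ℕ) (e : ι → ℕ) (S : Set ι) : Prop :=
  Capped g r e ∧ ∀ i, low g e (g i) = r (g i) ↔ i ∈ S

/-- Raising the exponent at `k` raises the totals exactly at the members above `k`. None of these
may be tight afterwards, so none may be one short of its rank before. -/
theorem tightAt_add_single {e : ι → ℕ} {S : Set ι} {h k : ι} (hS : ∀ i ∈ S, ¬ h ≤ i)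
    (hk : h ≤ k) :
    TightAt g r (e + Pi.single k 1) S ↔
      TightAt g r e S ∧ ∀ i, k ≤ i → low g e (g i) + 1 ≠ r (g i) := by
  simp only [TightAt, Capped, low_add, low_single, OrderEmbedding.le_iff_le]
  constructor
  · rintro ⟨h1, h2⟩
    refine ⟨⟨fun i => (Nat.le_add_right _ _).trans (h1 i), fun i => ?_⟩, fun i hi hi' => ?_⟩
    · rw [← h2 i]
      by_cases hki : k ≤ i
      · have h4 := (h2 i).not.2 fun hi => hS i hi (hk.trans hki)
        have h3 := h1 i
        simp only [hki, if_true] at h3 h4 ⊢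
        omega
      · simp [hki]
    · have := (h2 i).1 (by simpa [hi] using hi')
      exact hS i this (hk.trans hi)
  · rintro ⟨⟨h1, h2⟩, h3⟩
    have h5 : ∀ i, k ≤ i → low g e (g i) + 1 < r (g i) := fun i hi => by
      have h6 := (h2 i).not.2 fun hi' => hS i hi' (hk.trans hi)
      have := h3 i hi
      have := h1 i
      omega
    refine ⟨fun i => ?_, fun i => ?_⟩
    · split_ifs with hki
      · exact (h5 i hki).le
      · exact h1 i
    · rw [← h2 i]
      split_ifs with hki
      · have := h5 i hki
        omega
      · simp

/-- Here `h` itself must become tight and nothing strictly above it may, which says that `h` is a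
maximal almost tight member. -/
theorem tightAt_add_single_self {e : ι → ℕ} {S : Set ι} {h : ι} (hS : ∀ i ∈ S, ¬ h ≤ i) :
    TightAt g r (e + Pi.single h 1) (insert h S) ↔
      TightAt g r e S ∧ low g e (g h) + 1 = r (g h) ∧
        ∀ i, h < i → low g e (g i) + 1 ≠ r (g i) := by
  simp only [TightAt, Capped, low_add, low_single, OrderEmbedding.le_iff_le, Set.mem_insert_iff]
  constructor
  · rintro ⟨h1, h2⟩
    have h0 : low g e (g h) + 1 = r (g h) := by simpa using (h2 h).2 (Or.inl rfl)
    refine ⟨⟨fun i => (Nat.le_add_right _ _).trans (h1 i), fun i => ?_⟩, h0, fun i hi hi' => ?_⟩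
    · by_cases hki : h ≤ i
      · have h3 := h1 i
        simp only [hki, if_true] at h3
        have h4 : i ∉ S := fun hi => hS i hi hki
        simp only [h4, iff_false]
        omega
      · have h3 := h2 i
        have h4 : i ≠ h := fun hi => hki hi.ge
        simpa [hki, h4] using h3
    · rcases (h2 i).1 (by simpa [hi.le] using hi') with h3 | h3
      · exact hi.ne' h3
      · exact hS i h3 hi.le
  · rintro ⟨⟨h1, h2⟩, h0, h3⟩
    have h5 : ∀ i, h < i → low g e (g i) + 1 < r (g i) := fun i hi => by
      have h6 := (h2 i).not.2 fun hi' => hS i hi' hi.le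
      have := h3 i hi
      have := h1 i
      omega
    refine ⟨fun i => ?_, fun i => ?_⟩
    · split_ifs with hki
      · rcases hki.eq_or_lt with rfl | hki
        · exact h0.le
        · exact (h5 i hki).le
      · exact h1 i
    · by_cases hki : h ≤ i
      · rcases hki.eq_or_lt with rfl | hki'
        · simpa using h0
        · have h6 := h5 i hki'
          have h4 : i ∉ S := fun hi => hS i hi hki
          simp only [hki, if_true, hki'.ne', h4, or_self, iff_false]
          omega
      · have h4 : i ≠ h := fun hi => hki hi.ge
        simpa [hki, h4] using h2 i

/-- Möbius inversion of the tightness indicator above a member `h` not below a tight one. -/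
theorem IsBuilding.sum_mob_tightAt (hB : IsBuilding g r t) (ht : ∀ i, g i ≤ t) (e : ι → ℕ)
    (S : Set ι) (h : ι) (hS : ∀ i ∈ S, ¬ h ≤ i) :
    (∑ k with h ≤ k, mob h k * if TightAt g r (e + Pi.single k 1) S then 1 else 0) =
      if IsMax h then (if TightAt g r (e + Pi.single h 1) S then 1 else 0)
      else - if TightAt g r (e + Pi.single h 1) (insert h S) then 1 else 0 := by
  by_cases hP : TightAt g r e S
  swap
  · rw [Finset.sum_eq_zero]
    · simp [tightAt_add_single hS le_rfl, tightAt_add_single_self hS, hP]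
    · intro k hk
      simp [tightAt_add_single hS (Finset.mem_filter.1 hk).2, hP]
  have hh : ∀ k, h ≤ k → low g e (g k) ≠ r (g k) := fun k hk hk' => hS k ((hP.2 k).1 hk') hk
  by_cases hne : ∃ k, h ≤ k ∧ low g e (g k) + 1 = r (g k)
  · obtain ⟨n, hn, hn', hmax⟩ := hB.exists_near_max ht hP.1 hh hne
    -- The almost tight members above `h` have a greatest element `n`, so only `k ≤ n` obstructs.
    -- The sum becomes a difference of two Möbius sums, with value `[h maximal] - [h = n]`.
    have key : ∀ k, h ≤ k → (TightAt g r (e + Pi.single k 1) S ↔ ¬ k ≤ n) := fun k hk => by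
      rw [tightAt_add_single hS hk]
      constructor
      · rintro ⟨_, h2⟩ hkn
        exact h2 n hkn hn'
      · intro hkn
        exact ⟨hP, fun i hi hi' => hkn (hi.trans (hmax i (hk.trans hi) hi'))⟩
    have h1 : (∑ k with h ≤ k, mob h k * if TightAt g r (e + Pi.single k 1) S then (1 : ℚ) else 0) =
        ∑ k with h ≤ k, mob h k - ∑ k with h ≤ k ∧ k ≤ n, mob h k := by
      rw [← Finset.filter_filter, Finset.sum_filter (fun k => k ≤ n), ← Finset.sum_sub_distrib]
      refine Finset.sum_congr rfl fun k hk => ?_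
      rw [key k (Finset.mem_filter.1 hk).2]
      by_cases hkn : k ≤ n <;> simp [hkn]
    rw [h1, hB.sum_mob ht, sum_mob_right]
    by_cases hm : IsMax h
    · have : h = n := le_antisymm hn (hm hn)
      simp only [key h le_rfl, hm, if_true]
      simp [this]
    · have : TightAt g r (e + Pi.single h 1) (insert h S) ↔ h = n := by
        rw [tightAt_add_single_self hS]
        constructor
        · rintro ⟨_, _, h3⟩
          by_contra hne
          exact h3 n (lt_of_le_of_ne hn hne) hn'
        · rintro rfl
          exact ⟨hP, hn', fun i hi hi' => hi.not_ge (hmax i hi.le hi')⟩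
      simp [hm, this]
  · push Not at hne
    have h1 : (∑ k with h ≤ k, mob h k * if TightAt g r (e + Pi.single k 1) S then (1 : ℚ) else 0) =
        ∑ k with h ≤ k, mob h k := by
      refine Finset.sum_congr rfl fun k hk => ?_
      have hk := (Finset.mem_filter.1 hk).2
      rw [if_pos ((tightAt_add_single hS hk).2 ⟨hP, fun i hi => hne i (hk.trans hi)⟩), mul_one]
    rw [h1, hB.sum_mob ht]
    have h2 := (tightAt_add_single (g := g) (r := r) hS le_rfl).2 ⟨hP, hne⟩
    have h3 : ¬ TightAt g r (e + Pi.single h 1) (insert h S) := fun h3 =>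
      hne h le_rfl ((tightAt_add_single_self hS).1 h3).2.1
    simp [h2, h3]

end Tight

end BuildingSet

namespace BuildingSet

/-! ### A functional that vanishes on the relations -/

section Functional

open scoped Classical
open MvPolynomial

variable {ι L : Type*} [Fintype ι] [PartialOrder ι] [Lattice L] [OrderBot L]
  {g : ι ↪o L} {r : L → ℕ} {t : L}

/-- The sum of the variables above `i`. -/
noncomputable def upVar (i : ι) : MvPolynomial ι ℚ := ∑ k with i ≤ k, X k

/-- The Möbius inverse of `upVar`. -/
noncomputable def dualVar (h : ι) : MvPolynomial ι ℚ := ∑ k with h ≤ k, C (mob h k) * X k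

/-- The change of variables sending `upVar i` to `X i`. -/
noncomputable def dualHom : MvPolynomial ι ℚ →ₐ[ℚ] MvPolynomial ι ℚ := aeval dualVar

theorem dualHom_X (i : ι) : dualHom (X i) = dualVar i := aeval_X _ _

theorem dualHom_upVar (i : ι) : dualHom (upVar i) = X i := by
  rw [upVar, map_sum, Finset.sum_filter]
  simp_rw [dualHom_X, dualVar, Finset.sum_filter]
  have h1 : ∀ k : ι, (if i ≤ k then ∑ l, if k ≤ l then C (mob k l) * X l else 0 else 0) =
      ∑ l, (if i ≤ k ∧ k ≤ l then C (mob k l) else 0) * (X l : MvPolynomial ι ℚ) := fun k => by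
    by_cases hk : i ≤ k <;> simp [hk]
  simp_rw [h1]
  rw [Finset.sum_comm]
  simp_rw [← Finset.sum_mul]
  have h2 : ∀ l : ι, (∑ k, if i ≤ k ∧ k ≤ l then (C (mob k l) : MvPolynomial ι ℚ) else 0) =
      if i = l then 1 else 0 := fun l => by
    rw [← Finset.sum_filter, ← map_sum, sum_mob_left]
    split_ifs <;> simp
  simp_rw [h2]
  simp

/-- The linear functional which is the indicator, on monomials, of the exponents all of whose
totals are smaller than the ranks. -/
noncomputable def ell (g : ι ↪o L) (r : L → ℕ) : MvPolynomial ι ℚ →ₗ[ℚ] ℚ :=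
  (basisMonomials ι ℚ).constr ℚ fun c => if ∀ i, low g c (g i) < r (g i) then 1 else 0

theorem ell_monomial (c : ι →₀ ℕ) :
    ell g r (monomial c 1) = if ∀ i, low g c (g i) < r (g i) then 1 else 0 := by
  have := (basisMonomials ι ℚ).constr_basis ℚ
    (fun c : ι →₀ ℕ => if ∀ i, low g c (g i) < r (g i) then (1 : ℚ) else 0) c
  rwa [coe_basisMonomials] at this

/-- The indicator function of a finite set. -/
noncomputable def ind (T : Finset ι) : ι → ℕ := fun i => if i ∈ T then 1 else 0

/-- Remove a maximal element `h` of `T` and expand only `dualVar h`. Every prescribed tight member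
that remains is not above `h`, so `sum_mob_tightAt` applies. A non-maximal `h` joins the tight set
and contributes a sign; a maximal one does neither. -/
theorem IsBuilding.ell_monomial_mul_prod (hB : IsBuilding g r t) (ht : ∀ i, g i ≤ t)
    (T : Finset ι) (c : ι →₀ ℕ) :
    ell g r (monomial c 1 * ∏ h ∈ T, dualVar h) =
      if TightAt g r (c + ind T) {i | i ∈ T ∧ ¬ IsMax i} then
        (-1) ^ (T.filter fun i => ¬ IsMax i).card else 0 := by
  induction T using Finset.strongInduction generalizing c with
  | H T ih =>
    rcases T.eq_empty_or_nonempty with rfl | hne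
    · have h0 : (c + ind (∅ : Finset ι) : ι → ℕ) = c := by ext; simp [ind]
      rw [Finset.prod_empty, mul_one, ell_monomial, h0]
      simp only [Finset.notMem_empty, false_and, Set.ofPred_false, Finset.filter_empty,
        Finset.card_empty, pow_zero, TightAt, Capped, Set.mem_empty_iff_false, iff_false]
      congr 1
      exact propext ⟨fun h => ⟨fun i => (h i).le, fun i => (h i).ne⟩,
        fun h i => lt_of_le_of_ne (h.1 i) (h.2 i)⟩
    · obtain ⟨h, hh⟩ := T.exists_maximal hne
      set T' := T.erase h with hT'
      have hhT' : h ∉ T' := Finset.notMem_erase _ _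
      have hT : T = insert h T' := (Finset.insert_erase hh.1).symm
      have hlt : T' ⊂ T := Finset.erase_ssubset hh.1
      set S : Set ι := {i | i ∈ T' ∧ ¬ IsMax i} with hS
      have hSh : ∀ i ∈ S, ¬ h ≤ i := fun i hi hhi => by
        have := hh.eq_of_le (Finset.mem_of_mem_erase hi.1) hhi
        exact Finset.ne_of_mem_erase hi.1 this.symm
      have h1 : monomial c 1 * ∏ h ∈ T, dualVar h = ∑ k with h ≤ k,
          mob h k • (monomial (c + Finsupp.single k 1) (1 : ℚ) * ∏ h ∈ T', dualVar h) := by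
        rw [hT, Finset.prod_insert hhT', ← mul_assoc, dualVar, Finset.mul_sum, Finset.sum_mul]
        refine Finset.sum_congr rfl fun k _ => ?_
        rw [← smul_mul_assoc]
        congr 1
        rw [X, C_mul_monomial, monomial_mul, smul_monomial]
        simp
      have h2 : ∀ k, ((c + Finsupp.single k 1 : ι →₀ ℕ) + ind T' : ι → ℕ) =
          (c + ind T' : ι → ℕ) + Pi.single k 1 := fun k => by
        ext i
        simp only [Finsupp.coe_add, Finsupp.single_eq_pi_single, Pi.add_apply]
        omega
      have h3 : (c + ind T : ι → ℕ) = (c + ind T' : ι → ℕ) + Pi.single h 1 := by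
        ext i
        rw [hT]
        by_cases hi : i = h
        · subst hi
          simp [ind, hhT']
        · simp [ind, hi]
      rw [h1, map_sum]
      simp_rw [map_smul, ih T' hlt, smul_eq_mul, h2, ← hS]
      have h4 : ∀ k, (mob h k * if TightAt g r ((c + ind T' : ι → ℕ) + Pi.single k 1) S then
          (-1 : ℚ) ^ (T'.filter fun i => ¬ IsMax i).card else 0) =
          (-1) ^ (T'.filter fun i => ¬ IsMax i).card *
          (mob h k * if TightAt g r ((c + ind T' : ι → ℕ) + Pi.single k 1) S then 1 else 0) :=
        fun k => by split_ifs <;> ring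
      simp_rw [h4]
      rw [← Finset.mul_sum, hB.sum_mob_tightAt ht _ S h hSh, h3]
      by_cases hm : IsMax h
      · have h5 : {i | i ∈ T ∧ ¬ IsMax i} = S := by
          ext i
          simp only [hT, Finset.mem_insert, Set.mem_ofPred_eq, hS]
          constructor
          · rintro ⟨rfl | h, h'⟩
            · exact absurd hm h'
            · exact ⟨h, h'⟩
          · exact fun h => ⟨Or.inr h.1, h.2⟩
        have h6 : (T.filter fun i => ¬ IsMax i) = T'.filter fun i => ¬ IsMax i := by
          rw [hT, Finset.filter_insert, if_neg (not_not.2 hm)]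
        rw [if_pos hm, h5, h6]
        split_ifs <;> simp
      · have h5 : {i | i ∈ T ∧ ¬ IsMax i} = insert h S := by
          ext i
          simp only [hT, Finset.mem_insert, Set.mem_ofPred_eq, hS, Set.mem_insert_iff]
          constructor
          · rintro ⟨rfl | h, h'⟩
            · exact Or.inl rfl
            · exact Or.inr ⟨h, h'⟩
          · rintro (rfl | h)
            · exact ⟨Or.inl rfl, hm⟩
            · exact ⟨Or.inr h.1, h.2⟩
        have h6 : (T.filter fun i => ¬ IsMax i).card =
            (T'.filter fun i => ¬ IsMax i).card + 1 := by
          rw [hT, Finset.filter_insert, if_pos hm, Finset.card_insert_of_notMem]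
          simp [hhT']
        rw [if_neg hm, h5, h6]
        split_ifs <;> simp [pow_succ]

/-- The relation attached to a set `S` and a member `i`. -/
noncomputable def relation (g : ι ↪o L) (r : L → ℕ) (S : Finset ι) (i : ι) : MvPolynomial ι ℚ :=
  (∏ h ∈ S, X h) * upVar i ^ (r (g i) - r ((S.filter fun h => h < i).sup g))

/-- The ideal generated by the relations. -/
noncomputable def relIdeal (g : ι ↪o L) (r : L → ℕ) : Ideal (MvPolynomial ι ℚ) :=
  Ideal.span {p | ∃ S i, p = relation g r S i}

/-- If the value were nonzero, the members of `T` would be tight, being below `i` and hence not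
maximal, and so would their join. The power of `X i` then fills the total at `i` up to its rank,
although `i ∉ T` must not be tight. -/
theorem IsBuilding.ell_mul_eq_zero (hB : IsBuilding g r t) (ht : ∀ i, g i ≤ t) (T : Finset ι)
    (i : ι) (hT : ∀ h ∈ T, h < i) (q : MvPolynomial ι ℚ) :
    ell g r (q * ((∏ h ∈ T, dualVar h) * X i ^ (r (g i) - r (T.sup g)))) = 0 := by
  induction q using MvPolynomial.induction_on' with
  | add p q hp hq => rw [add_mul, map_add, hp, hq, add_zero]
  | monomial u a =>
    set b := r (g i) - r (T.sup g) with hb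
    have h1 : monomial u a * ((∏ h ∈ T, dualVar h) * X i ^ b) =
        a • (monomial (u + Finsupp.single i b) 1 * ∏ h ∈ T, dualVar h) := by
      rw [mul_comm (∏ h ∈ T, dualVar h), ← mul_assoc, X_pow_eq_monomial, monomial_mul,
        ← smul_mul_assoc, smul_monomial]
      simp
    rw [h1, map_smul, hB.ell_monomial_mul_prod ht, if_neg, smul_zero]
    rintro ⟨hc, hS⟩
    set e : ι → ℕ := (u + Finsupp.single i b : ι →₀ ℕ) + ind T with he
    have hiT : i ∉ T := fun h => lt_irrefl i (hT i h)
    have h2 : low g e (g i) ≠ r (g i) := fun h => hiT ((hS i).1 h).1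
    have h3 : low g e (T.sup g) = r (T.sup g) := by
      refine hB.low_finset_sup ht hc T fun j hj => (hS j).2 ⟨hj, fun hm => ?_⟩
      exact (hT j hj).not_ge (hm (hT j hj).le)
    have h4 : T.sup g ≤ g i := Finset.sup_le fun j hj => g.le_iff_le.2 (hT j hj).le
    -- When the join of `T` is already `g i`, the power is zero and `i` is tight without its help.
    rcases h4.eq_or_lt with h5 | h5
    · rw [h5] at h3
      exact h2 h3
    · have h6 : b + low g e (T.sup g) ≤ low g e (g i) := by
        have h7 : i ∉ Finset.univ.filter fun j => g j ≤ T.sup g := by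
          simpa using fun h => h5.not_ge h
        have h8 : b ≤ e i := by
          simp only [he, Finsupp.coe_add, Pi.add_apply, Finsupp.single_eq_same]
          omega
        calc b + low g e (T.sup g) ≤ e i + low g e (T.sup g) := by omega
          _ = ∑ j ∈ insert i (Finset.univ.filter fun j => g j ≤ T.sup g), e j := by
            rw [Finset.sum_insert h7]; rfl
          _ ≤ low g e (g i) := by
            refine Finset.sum_le_sum_of_subset fun j hj => ?_
            simp only [Finset.mem_insert, Finset.mem_filter, Finset.mem_univ, true_and] at hj ⊢
            rcases hj with rfl | hj
            · exact le_rfl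
            · exact hj.trans h4
      have h9 := hc i
      have h10 := hB.strictMono h5
      omega

theorem IsBuilding.ell_dualHom_eq_zero (hB : IsBuilding g r t) (ht : ∀ i, g i ≤ t)
    {p : MvPolynomial ι ℚ} (hp : p ∈ relIdeal g r) : ell g r (dualHom p) = 0 := by
  suffices ∀ q, ell g r (q * dualHom p) = 0 by simpa using this 1
  refine Submodule.span_induction (p := fun p _ => ∀ q, ell g r (q * dualHom p) = 0)
    ?_ (by simp) ?_ ?_ hp
  · rintro _ ⟨S, i, rfl⟩ q
    have := hB.ell_mul_eq_zero ht (S.filter fun h => h < i) i (by simp)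
      (q * ∏ h ∈ S.filter fun h => ¬ h < i, dualVar h)
    rw [← this, relation, map_mul dualHom, map_pow, map_prod, dualHom_upVar]
    simp_rw [dualHom_X]
    rw [← Finset.prod_filter_mul_prod_filter_not S (fun h => h < i)]
    congr 1
    ring
  · intro x y _ _ hx hy q
    rw [map_add, mul_add, map_add, hx, hy, add_zero]
  · intro a x _ hx q
    rw [smul_eq_mul, map_mul dualHom, ← mul_assoc]
    exact hx _

end Functional

end BuildingSet

namespace BuildingSet

/-! ### Standard exponents and linear independence -/

section Standard

open scoped Classical
open MvPolynomial

variable {ι L : Type*} [Fintype ι] [PartialOrder ι] [Lattice L] [OrderBot L]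
  {g : ι ↪o L} {r : L → ℕ} {t : L}

/-- The join of the members strictly below `i` in the support of `a`. -/
noncomputable def subJoin (g : ι ↪o L) (a : ι → ℕ) (i : ι) : L :=
  (Finset.univ.filter fun j => j < i ∧ a j ≠ 0).sup g

/-- The standard exponents. -/
def IsStd (g : ι ↪o L) (r : L → ℕ) (a : ι → ℕ) : Prop :=
  ∀ i, a i + r (subJoin g a i) < r (g i)

/-- The bound for the exponent of `i` in a standard exponent. -/
noncomputable def gap (g : ι ↪o L) (r : L → ℕ) (a : ι → ℕ) (i : ι) : ℕ :=
  r (g i) - r (subJoin g a i)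

theorem subJoin_congr {a b : ι → ℕ} {i : ι} (hab : ∀ j < i, a j = b j) :
    subJoin g a i = subJoin g b i := by
  unfold subJoin
  congr 1
  ext j
  simp only [Finset.mem_filter, Finset.mem_univ, true_and]
  exact and_congr_right fun h => by rw [hab j h]

/-- The gaps telescope along the nested structure: every factor `k` of the join of `R` lies in `R`,
its gap is the rank not yet covered by the support strictly below it, and the rest follows by
induction on `R`. -/
theorem IsBuilding.sum_gap (hB : IsBuilding g r t) (ht : ∀ i, g i ≤ t) {a : ι → ℕ}
    (ha : IsStd g r a) (R : Finset ι) (hR : ∀ j ∈ R, a j ≠ 0)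
    (hlow : ∀ j ∈ R, ∀ i ≤ j, a i ≠ 0 → i ∈ R) :
    ∑ j ∈ R, gap g r a j = r (R.sup g) := by
  induction R using Finset.strongInduction with
  | H R ih =>
    set F := R.sup g with hF
    have hFt : F ≤ t := Finset.sup_le fun i _ => ht i
    have hx : (fac g F).sup (fun k => (R.filter (· ≤ k)).sup g) = F := by
      apply le_antisymm
      · exact Finset.sup_le fun k _ => Finset.sup_mono (Finset.filter_subset _ _)
      · refine Finset.sup_le fun j hj => ?_
        obtain ⟨k, hk, hjk⟩ := exists_mem_fac (Finset.le_sup (f := g) hj)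
        refine le_trans ?_ (Finset.le_sup (f := fun k => (R.filter (· ≤ k)).sup g) hk)
        exact Finset.le_sup (f := g) (Finset.mem_filter.2 ⟨hj, hjk⟩)
    have hfac : ∀ k ∈ fac g F, k ∈ R := fun k hk => by
      have h1 := hB.sup_inf_eq hFt (fun k => (R.filter (· ≤ k)).sup g)
        (fun i _ => Finset.sup_le fun j hj => g.le_iff_le.2 (Finset.mem_filter.1 hj).2) hk
      rw [hx, inf_eq_right.2 (mem_fac.1 hk).1] at h1
      by_contra hkR
      -- If `k` were not in `R`, then `g k` would be a join of support members strictly below it,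
      -- which leaves no room for a standard exponent at `k`.
      have h2 : g k ≤ subJoin g a k := by
        rw [h1]
        refine Finset.sup_mono fun j hj => ?_
        obtain ⟨hj, hjk⟩ := Finset.mem_filter.1 hj
        simp only [Finset.mem_filter, Finset.mem_univ, true_and]
        exact ⟨lt_of_le_of_ne hjk fun h => hkR (h ▸ hj), hR j hj⟩
      have := hB.strictMono.monotone h2
      have := ha k
      omega
    have h1 : ∑ j ∈ R, gap g r a j =
        ∑ j with g j ≤ F, if j ∈ R then gap g r a j else 0 := by
      rw [← Finset.sum_filter]
      refine Finset.sum_congr ?_ fun _ _ => rfl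
      ext j
      simp only [Finset.mem_filter, Finset.mem_univ, true_and]
      exact ⟨fun hj => ⟨Finset.le_sup (f := g) hj, hj⟩, fun h => h.2⟩
    rw [h1, hB.sum_le_eq hFt, hB.rk_eq F hFt]
    refine Finset.sum_congr rfl fun k hk => ?_
    have hkR := hfac k hk
    set Rk := Finset.univ.filter fun j => j < k ∧ a j ≠ 0 with hRk
    have hsub : ∀ j ∈ Rk, j ∈ R := fun j hj => by
      obtain ⟨h1, h2⟩ := (Finset.mem_filter.1 hj).2
      exact hlow k hkR j h1.le h2
    have hkRk : k ∉ Rk := by simp [hRk]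
    have hss : Rk ⊂ R := (Finset.ssubset_iff_of_subset hsub).2 ⟨k, hkR, hkRk⟩
    have h2 := ih Rk hss (fun j hj => hR j (hsub j hj)) fun j hj i hij hi => by
      obtain ⟨h1, h2⟩ := (Finset.mem_filter.1 hj).2
      exact Finset.mem_filter.2 ⟨Finset.mem_univ _, hij.trans_lt h1, hi⟩
    have h3 : (∑ j with j ≤ k, if j ∈ R then gap g r a j else 0) =
        ∑ j ∈ insert k Rk, gap g r a j := by
      rw [← Finset.sum_filter]
      refine Finset.sum_congr ?_ fun _ _ => rfl
      ext j
      simp only [Finset.mem_filter, Finset.mem_univ, true_and, Finset.mem_insert]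
      constructor
      · rintro ⟨hjk, hj⟩
        rcases hjk.eq_or_lt with rfl | hjk
        · exact Or.inl rfl
        · exact Or.inr (Finset.mem_filter.2 ⟨Finset.mem_univ _, hjk, hR j hj⟩)
      · rintro (rfl | hj)
        · exact ⟨le_rfl, hkR⟩
        · exact ⟨(Finset.mem_filter.1 hj).2.1.le, hsub j hj⟩
    rw [h3, Finset.sum_insert hkRk, h2]
    have := ha k
    change gap g r a k + r (subJoin g a k) = _
    unfold gap
    omega

/-- The exponent dual to a standard exponent. -/
noncomputable def dualExp (g : ι ↪o L) (r : L → ℕ) (a : ι → ℕ) (i : ι) : ℕ :=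
  if IsMax i then gap g r a i - 1 - a i else if a i = 0 then 0 else gap g r a i - a i

/-- Members strictly below `i` are not maximal, so there `b + dualExp g r b` is the gap on the
support of `b` and zero off it. These gaps add up to the rank of `subJoin g b i`. -/
theorem IsBuilding.low_add_dualExp (hB : IsBuilding g r t) (ht : ∀ i, g i ≤ t) {a b : ι → ℕ}
    (hb : IsStd g r b) {i : ι} (hab : ∀ j < i, a j = b j) :
    low g (a + dualExp g r b) (g i) = a i + dualExp g r b i + r (subJoin g b i) := by
  rw [low_apply]
  have h1 : (Finset.univ.filter fun j => j ≤ i) =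
      insert i (Finset.univ.filter fun j => j < i) := by
    ext j
    simp [le_iff_eq_or_lt]
  rw [h1, Finset.sum_insert (by simp)]
  congr 1
  rw [subJoin, ← hB.sum_gap ht hb]
  · rw [← Finset.filter_filter, Finset.sum_filter (fun j => b j ≠ 0)]
    refine Finset.sum_congr rfl fun j hj => ?_
    have hj := (Finset.mem_filter.1 hj).2
    have hm : ¬ IsMax j := fun hm => hj.not_ge (hm hj.le)
    have h2 := hb j
    by_cases hbj : b j = 0
    · simp [dualExp, hm, hab j hj, hbj]
    · simp only [Pi.add_apply, hab j hj, dualExp, hm, if_false, hbj, gap, ne_eq,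
        not_false_eq_true, if_true]
      omega
  · intro j hj
    exact (Finset.mem_filter.1 hj).2.2
  · intro j hj k hk hk0
    exact Finset.mem_filter.2 ⟨Finset.mem_univ _, hk.trans_lt (Finset.mem_filter.1 hj).2.1, hk0⟩

theorem IsBuilding.tightAt_dualExp_self (hB : IsBuilding g r t) (ht : ∀ i, g i ≤ t) {a : ι → ℕ}
    (ha : IsStd g r a) : TightAt g r (a + dualExp g r a) {i | a i ≠ 0 ∧ ¬ IsMax i} := by
  simp only [TightAt, Capped, hB.low_add_dualExp ht ha fun _ _ => rfl]
  refine ⟨fun i => ?_, fun i => ?_⟩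
  all_goals
    have h1 := ha i
    simp only [dualExp, gap]
    by_cases hm : IsMax i
    · simp only [hm, if_true, Set.mem_ofPred_eq, not_true_eq_false, and_false, iff_false]
      omega
    · by_cases h0 : a i = 0
      · simp only [hm, if_false, Set.mem_ofPred_eq, h0, if_true, ne_eq, not_true_eq_false,
          false_and, iff_false]
        omega
      · simp only [hm, if_false, Set.mem_ofPred_eq, h0, ne_eq, not_false_eq_true, and_self,
          iff_true]
        omega

/-- This is the triangularity of the pairing. At the first disagreement, the total at `i` must be
the rank or below it as tightness prescribes, and either requirement excludes `a i > b i`. -/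
theorem IsBuilding.lt_of_tightAt_dualExp (hB : IsBuilding g r t) (ht : ∀ i, g i ≤ t)
    {a b : ι → ℕ} (ha : IsStd g r a) (hb : IsStd g r b)
    (hab : TightAt g r (a + dualExp g r b) {i | a i ≠ 0 ∧ ¬ IsMax i}) {i : ι}
    (hi : ∀ j < i, a j = b j) (hne : a i ≠ b i) : a i < b i := by
  obtain ⟨h1, h2⟩ := hab
  have h1 := h1 i
  have h2 := h2 i
  have h3 := ha i
  have h4 := hb i
  rw [subJoin_congr hi] at h3
  rw [hB.low_add_dualExp ht hb hi] at h1 h2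
  simp only [dualExp, gap, Set.mem_ofPred_eq] at h1 h2
  by_cases hm : IsMax i
  · simp only [hm, if_true, not_true_eq_false, and_false, iff_false] at h1 h2
    omega
  · simp only [hm, if_false, not_false_eq_true, and_true] at h1 h2
    by_cases hb0 : b i = 0
    · simp only [hb0, if_true] at h1 h2
      have := h2.2 (by omega)
      omega
    · simp only [hb0, if_false] at h1 h2
      by_cases ha0 : a i = 0
      · omega
      · have := h2.2 ha0
        omega

/-- Lexicographic comparison along a linear extension of `ι` gives agreement at everything earlier
in the extension, in particular at everything below `i` in the partial order. -/
theorem exists_lex_min (s : Finset (ι → ℕ)) (hs : s.Nonempty) :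
    ∃ b ∈ s, ∀ a ∈ s, a ≠ b → ∃ i, (∀ j < i, a j = b j) ∧ b i < a i := by
  have : Finite (LinearExtension ι) := inferInstanceAs (Finite ι)
  obtain ⟨b, hb, hmin⟩ := s.exists_min_image
    (fun a : ι → ℕ => (toLex a : Lex (LinearExtension ι → ℕ))) hs
  refine ⟨b, hb, fun a ha hab => ?_⟩
  have h1 : (toLex b : Lex (LinearExtension ι → ℕ)) < (toLex a : Lex (LinearExtension ι → ℕ)) :=
    lt_of_le_of_ne (hmin a ha) fun h => hab (toLex.injective h).symm
  obtain ⟨i, hi, hi'⟩ := h1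
  refine ⟨i, fun j hj => (hi j ?_).symm, hi'⟩
  exact lt_of_le_of_ne (toLinearExtension.monotone hj.le) hj.ne

/-- The support of an exponent. -/
noncomputable def expSupp (a : ι → ℕ) : Finset ι := Finset.univ.filter fun i => a i ≠ 0

/-- The basis element attached to a standard exponent. -/
noncomputable def stdVec (a : ι → ℕ) : MvPolynomial ι ℚ :=
  (∏ i ∈ expSupp a, X i) * ∏ i, upVar i ^ (a i - 1)

/-- The functional dual to a standard exponent. -/
noncomputable def pairing (g : ι ↪o L) (r : L → ℕ) (b : ι → ℕ) : MvPolynomial ι ℚ →ₗ[ℚ] ℚ :=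
  ell g r ∘ₗ dualHom.toLinearMap ∘ₗ
    LinearMap.mulRight ℚ (∏ i, upVar i ^ dualExp g r b i)

theorem IsBuilding.pairing_eq_zero (hB : IsBuilding g r t) (ht : ∀ i, g i ≤ t) (b : ι → ℕ)
    {p : MvPolynomial ι ℚ} (hp : p ∈ relIdeal g r) : pairing g r b p = 0 :=
  hB.ell_dualHom_eq_zero ht (Ideal.mul_mem_right _ _ hp)

/-- After the change of variables the `upVar` factors become a monomial and the support becomes a
product of dual variables. The indicator of the support restores the one lowered from each nonzero
`a i`. -/
theorem IsBuilding.pairing_stdVec (hB : IsBuilding g r t) (ht : ∀ i, g i ≤ t) (a b : ι → ℕ) :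
    pairing g r b (stdVec a) =
      if TightAt g r (a + dualExp g r b) {i | a i ≠ 0 ∧ ¬ IsMax i} then
        (-1) ^ ((expSupp a).filter fun i => ¬ IsMax i).card else 0 := by
  have h1 : ∀ f : ι → ℕ, (∏ i, (X i : MvPolynomial ι ℚ) ^ f i) =
      monomial (Finsupp.equivFunOnFinite.symm f) 1 := fun f => by
    rw [monomial_eq, C_1, one_mul, Finsupp.prod_fintype _ _ (by simp)]
    rfl
  have h2 : dualHom (stdVec a * ∏ i, upVar i ^ dualExp g r b i) =
      monomial (Finsupp.equivFunOnFinite.symm fun i => (a i - 1) + dualExp g r b i) 1 *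
        ∏ i ∈ expSupp a, dualVar i := by
    rw [← h1, stdVec, map_mul, map_mul, map_prod, map_prod, map_prod]
    simp_rw [map_pow, dualHom_upVar, dualHom_X, pow_add, Finset.prod_mul_distrib]
    ring
  have h3 : ((Finsupp.equivFunOnFinite.symm fun i => (a i - 1) + dualExp g r b i : ι →₀ ℕ) +
      ind (expSupp a) : ι → ℕ) = a + dualExp g r b := by
    ext i
    by_cases hi : a i = 0
    · simp [ind, expSupp, hi]
    · simp only [Finsupp.coe_equivFunOnFinite_symm, Pi.add_apply, ind, expSupp,
        Finset.mem_filter, Finset.mem_univ, true_and, ne_eq, hi, not_false_eq_true, if_true]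
      omega
  change ell g r (dualHom (stdVec a * ∏ i, upVar i ^ dualExp g r b i)) = _
  rw [h2, hB.ell_monomial_mul_prod ht, h3]
  simp [expSupp]

/-- The finite set of standard exponents. -/
noncomputable def stdSet (g : ι ↪o L) (r : L → ℕ) : Finset (ι → ℕ) :=
  (Fintype.piFinset fun i => Finset.range (r (g i))).filter (IsStd g r)

theorem mem_stdSet {a : ι → ℕ} : a ∈ stdSet g r ↔ IsStd g r a := by
  simp only [stdSet, Finset.mem_filter, Fintype.mem_piFinset, Finset.mem_range,
    and_iff_right_iff_imp]
  exact fun h i => lt_of_le_of_lt (Nat.le_add_right _ _) (h i)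

/-- Pair a relation with the dual of its lexicographically least exponent `b`: every other term dies
by triangularity, and `b` pairs with itself to a sign. -/
theorem IsBuilding.stdVec_independent (hB : IsBuilding g r t) (ht : ∀ i, g i ≤ t)
    (s : Finset (ι → ℕ)) (hs : ∀ a ∈ s, IsStd g r a) (c : (ι → ℕ) → ℚ)
    (hc : ∑ a ∈ s, c a • stdVec a ∈ relIdeal g r) : ∀ a ∈ s, c a = 0 := by
  by_contra hne
  push Not at hne
  obtain ⟨b, hb, hmin⟩ := exists_lex_min (s.filter fun a => c a ≠ 0)
    (by obtain ⟨a, ha⟩ := hne; exact ⟨a, Finset.mem_filter.2 ha⟩)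
  obtain ⟨hbs, hb0⟩ := Finset.mem_filter.1 hb
  have h1 := hB.pairing_eq_zero ht b hc
  rw [map_sum, Finset.sum_eq_single b] at h1
  · rw [map_smul, hB.pairing_stdVec ht, if_pos (hB.tightAt_dualExp_self ht (hs b hbs)),
      smul_eq_mul] at h1
    rcases mul_eq_zero.1 h1 with h | h
    · exact hb0 h
    · exact pow_ne_zero _ (by norm_num) h
  · intro a ha hab
    by_cases hca : c a = 0
    · simp [hca]
    obtain ⟨i, hi, hlt⟩ := hmin a (Finset.mem_filter.2 ⟨ha, hca⟩) hab
    rw [map_smul, hB.pairing_stdVec ht, if_neg, smul_zero]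
    intro hT
    exact (hB.lt_of_tightAt_dualExp ht (hs a ha) (hs b hbs) hT hi hlt.ne').not_gt hlt
  · exact fun h => absurd hbs h

/-- Adding the dual exponent leaves every maximal member short of its rank. The factors of `t` are
maximal, so the total over `t` stays short as well. -/
theorem IsBuilding.sum_lt_of_isStd (hB : IsBuilding g r t) (ht : ∀ i, g i ≤ t) (hbot : t ≠ ⊥)
    {a : ι → ℕ} (ha : IsStd g r a) : ∑ i, a i < r t := by
  have h0 : (fac g t).Nonempty := by
    rw [Finset.nonempty_iff_ne_empty]
    intro h
    have := hB.sup_fac le_rfl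
    rw [h, Finset.sup_empty] at this
    exact hbot this.symm
  have h1 : ∑ i, a i ≤ low g (a + dualExp g r a) t := by
    unfold low
    rw [Finset.filter_true_of_mem fun i _ => ht i]
    exact Finset.sum_le_sum fun i _ => Nat.le_add_right _ _
  refine h1.trans_lt ?_
  rw [hB.low_eq le_rfl, hB.rk_eq t le_rfl]
  refine Finset.sum_lt_sum_of_nonempty h0 fun i hi => ?_
  obtain ⟨h2, h3⟩ := hB.tightAt_dualExp_self ht ha
  refine lt_of_le_of_ne (h2 i) fun h => ((h3 i).1 h).2 fun k hk => ?_
  exact ((mem_fac.1 hi).2 k (ht k) hk).le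

end Standard

end BuildingSet

namespace BuildingSet

/-! ### Spanning by leading terms, and the Hilbert function -/

section Spanning

open scoped Classical
open MvPolynomial

variable {ι L : Type*} [Fintype ι] [PartialOrder ι] [Lattice L] [OrderBot L]
  {g : ι ↪o L} {r : L → ℕ} {t : L}

/-- The total weight of an exponent. -/
def expWt (ht : ι → ℕ) (c : ι →₀ ℕ) : ℕ := ∑ i, c i * ht i

theorem expWt_add (ht : ι → ℕ) (c d : ι →₀ ℕ) : expWt ht (c + d) = expWt ht c + expWt ht d := by
  simp [expWt, add_mul, Finset.sum_add_distrib]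

theorem expWt_single (ht : ι → ℕ) (i : ι) (n : ℕ) : expWt ht (Finsupp.single i n) = n * ht i := by
  simp [expWt, Finsupp.single_apply]

/-- The span of the monomials of degree `n` and weight at least `w`. -/
noncomputable def wtSpan (ht : ι → ℕ) (n w : ℕ) : Submodule ℚ (MvPolynomial ι ℚ) :=
  Submodule.span ℚ {p | ∃ c : ι →₀ ℕ, c.degree = n ∧ w ≤ expWt ht c ∧ p = monomial c 1}

theorem monomial_mem_wtSpan {ht : ι → ℕ} {n w : ℕ} {c : ι →₀ ℕ} (hn : c.degree = n)
    (hw : w ≤ expWt ht c) : monomial c (1 : ℚ) ∈ wtSpan ht n w :=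
  Submodule.subset_span ⟨c, hn, hw, rfl⟩

theorem wtSpan_anti {ht : ι → ℕ} {n w w' : ℕ} (h : w ≤ w') :
    wtSpan ht n w' ≤ wtSpan ht n w :=
  Submodule.span_mono fun _ ⟨c, hn, hw, hp⟩ => ⟨c, hn, h.trans hw, hp⟩

theorem mul_mem_wtSpan {ht : ι → ℕ} {n w n' w' : ℕ} {p q : MvPolynomial ι ℚ}
    (hp : p ∈ wtSpan ht n w) (hq : q ∈ wtSpan ht n' w') :
    p * q ∈ wtSpan ht (n + n') (w + w') := by
  have h1 : p * q ∈ wtSpan ht n w * wtSpan ht n' w' := Submodule.mul_mem_mul hp hq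
  refine (?_ : wtSpan ht n w * wtSpan ht n' w' ≤ _) h1
  rw [wtSpan, wtSpan, Submodule.span_mul_span, Submodule.span_le]
  rintro _ ⟨_, ⟨c, hc, hw, rfl⟩, _, ⟨d, hd, hw', rfl⟩, rfl⟩
  simp only [monomial_mul, mul_one, SetLike.mem_coe]
  exact monomial_mem_wtSpan (by rw [map_add, hc, hd]) (by rw [expWt_add]; omega)

/-- `p` is the monomial of exponent `c` plus terms of the same degree and larger weight. -/
def HasLead (ht : ι → ℕ) (p : MvPolynomial ι ℚ) (c : ι →₀ ℕ) : Prop :=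
  p - monomial c 1 ∈ wtSpan ht c.degree (expWt ht c + 1)

theorem HasLead.mul {ht : ι → ℕ} {p q : MvPolynomial ι ℚ} {c d : ι →₀ ℕ}
    (hp : HasLead ht p c) (hq : HasLead ht q d) : HasLead ht (p * q) (c + d) := by
  have h1 : p * q - monomial (c + d) 1 = (p - monomial c 1) * (q - monomial d 1) +
      (p - monomial c 1) * monomial d 1 + monomial c 1 * (q - monomial d 1) := by
    rw [show (monomial (c + d) (1 : ℚ)) = monomial c 1 * monomial d 1 by simp [monomial_mul]]
    ring
  have hc : monomial c (1 : ℚ) ∈ wtSpan ht c.degree (expWt ht c) :=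
    monomial_mem_wtSpan rfl le_rfl
  have hd : monomial d (1 : ℚ) ∈ wtSpan ht d.degree (expWt ht d) :=
    monomial_mem_wtSpan rfl le_rfl
  unfold HasLead
  rw [h1, map_add, expWt_add]
  refine Submodule.add_mem _ (Submodule.add_mem _ ?_ ?_) ?_
  · exact wtSpan_anti (by omega) (mul_mem_wtSpan hp hq)
  · exact wtSpan_anti (by omega) (mul_mem_wtSpan hp hd)
  · exact wtSpan_anti (by omega) (mul_mem_wtSpan hc hq)

theorem hasLead_monomial (ht : ι → ℕ) (c : ι →₀ ℕ) : HasLead ht (monomial c 1) c := by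
  simp [HasLead]

theorem HasLead.pow {ht : ι → ℕ} {p : MvPolynomial ι ℚ} {c : ι →₀ ℕ} (hp : HasLead ht p c)
    (n : ℕ) : HasLead ht (p ^ n) (n • c) := by
  induction n with
  | zero => simpa using hasLead_monomial ht 0
  | succ n ih =>
    rw [pow_succ, succ_nsmul]
    exact ih.mul hp

theorem HasLead.prod {ht : ι → ℕ} {κ : Type*} (s : Finset κ) {p : κ → MvPolynomial ι ℚ}
    {c : κ → ι →₀ ℕ} (hp : ∀ i ∈ s, HasLead ht (p i) (c i)) :
    HasLead ht (∏ i ∈ s, p i) (∑ i ∈ s, c i) := by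
  induction s using Finset.induction_on with
  | empty => simpa using hasLead_monomial ht 0
  | insert a s ha ih =>
    rw [Finset.prod_insert ha, Finset.sum_insert ha]
    exact (hp a (Finset.mem_insert_self _ _)).mul
      (ih fun i hi => hp i (Finset.mem_insert_of_mem hi))

/-- The other variables of `upVar i` belong to strictly larger members and so are heavier. -/
theorem hasLead_upVar {ht : ι → ℕ} (hht : StrictMono ht) (i : ι) :
    HasLead ht (upVar i) (Finsupp.single i 1) := by
  have h1 : (Finset.univ.filter fun k => i ≤ k) =
      insert i (Finset.univ.filter fun k => i < k) := by
    ext j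
    simp [le_iff_eq_or_lt, eq_comm]
  unfold HasLead
  rw [upVar, h1, Finset.sum_insert (by simp), ← X, add_sub_cancel_left]
  refine Submodule.sum_mem _ fun k hk => ?_
  have := hht (Finset.mem_filter.1 hk).2
  exact monomial_mem_wtSpan (by simp) (by simp only [expWt_single]; omega)

theorem hasLead_stdVec {ht : ι → ℕ} (hht : StrictMono ht) (c : ι →₀ ℕ) :
    HasLead ht (stdVec c) c := by
  have h1 := (HasLead.prod (ht := ht) (expSupp c) (c := fun i => Finsupp.single i 1)
    fun i _ => hasLead_monomial ht (Finsupp.single i 1)).mul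
    (HasLead.prod Finset.univ fun i _ => (hasLead_upVar hht i).pow (c i - 1))
  have h2 : ∑ i ∈ expSupp c, Finsupp.single i 1 +
      ∑ i, (c i - 1) • Finsupp.single i 1 = c := by
    ext j
    simp only [Finsupp.coe_add, Pi.add_apply, Finsupp.coe_finsetSum, Finset.sum_apply,
      Finsupp.single_apply, Finsupp.smul_single, smul_eq_mul, mul_one, Finset.sum_ite_eq',
      Finset.mem_univ, if_true, expSupp, Finset.mem_filter, true_and]
    split_ifs <;> omega
  rw [h2] at h1
  exact h1

/-- If standardness fails at `i`, take the relation for `i` and the support of `c` strictly below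
`i`. Its lightest monomial divides the monomial of `c`. -/
theorem exists_hasLead_of_not_isStd {ht : ι → ℕ} (hht : StrictMono ht) (c : ι →₀ ℕ)
    (hc : ¬ IsStd g r c) : ∃ p ∈ relIdeal g r, HasLead ht p c := by
  obtain ⟨i, hi⟩ := not_forall.1 hc
  push Not at hi
  set S := Finset.univ.filter fun j => j < i ∧ c j ≠ 0 with hS
  have hS' : (S.filter fun h => h < i) = S := Finset.filter_true_of_mem fun j hj =>
    (Finset.mem_filter.1 hj).2.1
  set b := r (g i) - r (S.sup g) with hb
  have h0 : HasLead ht (relation g r S i)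
      (∑ j ∈ S, Finsupp.single j 1 + b • Finsupp.single i 1) := by
    unfold relation
    rw [hS']
    exact (HasLead.prod _ fun j _ => hasLead_monomial ht (Finsupp.single j 1)).mul
      ((hasLead_upVar hht i).pow b)
  set d := ∑ j ∈ S, Finsupp.single j 1 + b • Finsupp.single i 1 with hd
  have hbc : b ≤ c i := by
    change r (g i) ≤ c i + r (S.sup g) at hi
    omega
  have hdc : d ≤ c := fun j => by
    simp only [hd, Finsupp.coe_add, Pi.add_apply, Finsupp.coe_finsetSum, Finset.sum_apply,
      Finsupp.single_apply, Finsupp.smul_single, smul_eq_mul, mul_one, Finset.sum_ite_eq']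
    by_cases hj : j ∈ S
    · have := (Finset.mem_filter.1 hj).2
      have h3 := this.1.ne'
      rw [if_pos hj, if_neg h3]
      omega
    · rw [if_neg hj, zero_add]
      split_ifs with h
      · exact h ▸ hbc
      · exact Nat.zero_le _
  refine ⟨relation g r S i * monomial (c - d) 1, Ideal.mul_mem_right _ _
    (Ideal.subset_span ⟨S, i, rfl⟩), ?_⟩
  have := h0.mul (hasLead_monomial ht (c - d))
  rwa [add_tsub_cancel_of_le hdc] at this

/-- Each monomial is rewritten modulo heavier ones of the same degree. In degree `n` the weight is
at most `n * r t`, so this terminates. -/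
theorem IsBuilding.monomial_mem (hB : IsBuilding g r t) (ht : ∀ i, g i ≤ t) {n : ℕ}
    (c : ι →₀ ℕ) (hc : c.degree = n) : monomial c (1 : ℚ) ∈
      (relIdeal g r).restrictScalars ℚ ⊔
        Submodule.span ℚ {p | ∃ a ∈ stdSet g r, ∑ i, a i = n ∧ p = stdVec a} := by
  set W := (relIdeal g r).restrictScalars ℚ ⊔
        Submodule.span ℚ {p | ∃ a ∈ stdSet g r, ∑ i, a i = n ∧ p = stdVec a} with hW
  set w : ι → ℕ := fun i => r (g i) with hw
  have hwm : StrictMono w := fun i j hij => hB.strictMono (g.lt_iff_lt.2 hij)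
  have hbound : ∀ c : ι →₀ ℕ, c.degree = n → expWt w c ≤ n * r t := fun c hc => by
    rw [← hc, Finsupp.degree_eq_sum, Finset.sum_mul]
    exact Finset.sum_le_sum fun i _ => Nat.mul_le_mul_left _ (hB.strictMono.monotone (ht i))
  induction hk : n * r t - expWt w c using Nat.strong_induction_on generalizing c with
  | _ k ih =>
    have h1 : wtSpan w n (expWt w c + 1) ≤ W := by
      refine Submodule.span_le.2 ?_
      rintro _ ⟨d, hd, hwd, rfl⟩
      have h2 := hbound d hd
      exact ih _ (by omega) d hd rfl
    obtain ⟨p, hp, hlead⟩ : ∃ p ∈ W, HasLead w p c := by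
      by_cases hstd : IsStd g r c
      · refine ⟨stdVec c, Submodule.mem_sup_right (Submodule.subset_span
          ⟨c, mem_stdSet.2 hstd, ?_, rfl⟩), hasLead_stdVec hwm c⟩
        rw [← hc, Finsupp.degree_eq_sum]
      · obtain ⟨p, hp, hlead⟩ := exists_hasLead_of_not_isStd (r := r) hwm c hstd
        exact ⟨p, Submodule.mem_sup_left hp, hlead⟩
    unfold HasLead at hlead
    rw [hc] at hlead
    have := Submodule.sub_mem _ hp (h1 hlead)
    rwa [sub_sub_cancel] at this

theorem isHomogeneous_stdVec (a : ι → ℕ) : (stdVec a).IsHomogeneous (∑ i, a i) := by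
  have h1 := (IsHomogeneous.prod (expSupp a) (fun i => (X i : MvPolynomial ι ℚ)) (fun _ => 1)
    fun i _ => isHomogeneous_X ℚ i).mul (IsHomogeneous.prod Finset.univ
      (fun i => upVar i ^ (a i - 1)) (fun i => 1 * (a i - 1)) fun i _ =>
        (IsHomogeneous.sum _ _ 1 fun k _ => isHomogeneous_X ℚ k).pow _)
  have h2 : ∑ i ∈ expSupp a, 1 + ∑ i, 1 * (a i - 1) = ∑ i, a i := by
    rw [expSupp, Finset.sum_filter, ← Finset.sum_add_distrib]
    refine Finset.sum_congr rfl fun i _ => ?_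
    split_ifs <;> omega
  rw [h2] at h1
  exact h1

/-- The degree `n` part of the quotient by the relations. -/
noncomputable def relPiece (g : ι ↪o L) (r : L → ℕ) (n : ℕ) :
    Submodule ℚ (MvPolynomial ι ℚ ⧸ relIdeal g r) :=
  (homogeneousSubmodule ι ℚ n).map (Ideal.Quotient.mkₐ ℚ (relIdeal g r)).toLinearMap

theorem IsBuilding.relPiece_eq_span (hB : IsBuilding g r t) (ht : ∀ i, g i ≤ t) (n : ℕ) :
    relPiece g r n = Submodule.span ℚ (Set.range fun a : {a // a ∈ stdSet g r ∧ ∑ i, a i = n} =>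
      Ideal.Quotient.mkₐ ℚ (relIdeal g r) (stdVec a.1)) := by
  apply le_antisymm
  · rw [relPiece, Submodule.map_le_iff_le_comap]
    intro p hp
    rw [p.as_sum]
    refine Submodule.sum_mem _ fun c hc => ?_
    have hdeg : c.degree = n := by
      by_contra h
      exact (mem_support_iff.1 hc) (((mem_homogeneousSubmodule _ _).1 hp).coeff_eq_zero h)
    have h1 : monomial c (coeff c p) = coeff c p • monomial c (1 : ℚ) := by
      rw [smul_monomial, smul_eq_mul, mul_one]
    rw [h1]
    refine Submodule.smul_mem _ _ ?_
    refine SetLike.le_def.1 (sup_le (c := Submodule.comap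
      (Ideal.Quotient.mkₐ ℚ (relIdeal g r)).toLinearMap _) ?_ ?_) (hB.monomial_mem ht c hdeg)
    · intro q hq
      have : Ideal.Quotient.mkₐ ℚ (relIdeal g r) q = 0 := Ideal.Quotient.eq_zero_iff_mem.2 hq
      rw [Submodule.mem_comap, AlgHom.toLinearMap_apply, this]
      exact Submodule.zero_mem _
    · refine Submodule.span_le.2 ?_
      rintro _ ⟨a, ha, hn, rfl⟩
      exact Submodule.subset_span ⟨⟨a, ha, hn⟩, rfl⟩
  · refine Submodule.span_le.2 ?_
    rintro _ ⟨⟨a, ha, hn⟩, rfl⟩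
    exact Submodule.mem_map_of_mem ((mem_homogeneousSubmodule _ _).2 (hn ▸ isHomogeneous_stdVec a))

/-- The Hilbert function counts standard exponents. -/
theorem IsBuilding.finrank_relPiece (hB : IsBuilding g r t) (ht : ∀ i, g i ≤ t) (n : ℕ) :
    Module.finrank ℚ (relPiece g r n) = ((stdSet g r).filter fun a => ∑ i, a i = n).card := by
  let : Fintype {a // a ∈ stdSet g r ∧ ∑ i, a i = n} :=
    Fintype.subtype ((stdSet g r).filter fun a => ∑ i, a i = n) (by simp)
  rw [hB.relPiece_eq_span ht, finrank_span_eq_card]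
  · exact Fintype.subtype_card _ _
  · rw [Fintype.linearIndependent_iff]
    intro c hc a
    set c' : (ι → ℕ) → ℚ := fun b =>
      if h : b ∈ stdSet g r ∧ ∑ i, b i = n then c ⟨b, h⟩ else 0 with hc'
    have h1 := hB.stdVec_independent ht ((stdSet g r).filter fun a => ∑ i, a i = n)
      (fun a ha => mem_stdSet.1 (Finset.mem_filter.1 ha).1) c' ?_ a.1
      (Finset.mem_filter.2 a.2)
    · simpa [hc', a.2] using h1
    · rw [← Ideal.Quotient.eq_zero_iff_mem, ← Ideal.Quotient.mkₐ_eq_mk ℚ, ← hc, map_sum]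
      rw [Finset.sum_subtype _ (p := fun a => a ∈ stdSet g r ∧ ∑ i, a i = n) (by simp)]
      refine Finset.sum_congr rfl fun b _ => ?_
      rw [map_smul]
      simp [hc', b.2]

theorem IsBuilding.relPiece_eq_bot (hB : IsBuilding g r t) (ht : ∀ i, g i ≤ t) (hbot : t ≠ ⊥)
    {n : ℕ} (hn : r t ≤ n) : relPiece g r n = ⊥ := by
  rw [hB.relPiece_eq_span ht, Submodule.span_eq_bot]
  rintro _ ⟨⟨a, ha, hs⟩, rfl⟩
  have := hB.sum_lt_of_isStd ht hbot (mem_stdSet.1 ha)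
  omega

end Spanning

end BuildingSet

namespace BuildingSet

/-! ### Splitting one factor off the top element -/

section Split

open scoped Classical

variable {ι L : Type*} [Fintype ι] [PartialOrder ι] [Lattice L] [OrderBot L]
  {g : ι ↪o L} {r : L → ℕ} {t : L}

/-- The join of the factors of `t` other than `m`. -/
noncomputable def cofac (g : ι ↪o L) (t : L) (m : ι) : L := ((fac g t).erase m).sup g

theorem cofac_le {m : ι} : cofac g t m ≤ t :=
  Finset.sup_le fun _ hi => (mem_fac.1 (Finset.mem_of_mem_erase hi)).1

theorem IsBuilding.cofac_inf (hB : IsBuilding g r t) {m : ι} (hm : m ∈ fac g t) :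
    cofac g t m ⊓ g m = ⊥ := by
  have h1 := hB.sup_inf_eq le_rfl (fun k => if k = m then ⊥ else g k)
    (fun k _ => by by_cases hk : k = m <;> simp [hk]) hm
  rw [← Finset.insert_erase hm, Finset.sup_insert] at h1
  simp only [if_true, bot_sup_eq] at h1
  rw [← h1]
  congr 1
  refine Finset.sup_congr rfl fun k hk => ?_
  rw [if_neg (Finset.ne_of_mem_erase hk)]

theorem IsBuilding.sup_erase_inf (hB : IsBuilding g r t) {m : ι} (hm : m ∈ fac g t) {y : L}
    (hy : y ≤ cofac g t m) : (((fac g t).erase m).sup fun k => y ⊓ g k) = y := by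
  have h1 := hB.sup_inf le_rfl (hy.trans cofac_le)
  rw [← Finset.insert_erase hm, Finset.sup_insert] at h1
  have h2 : y ⊓ g m = ⊥ := le_bot_iff.1 (hB.cofac_inf hm ▸ inf_le_inf_right _ hy)
  rwa [h2, bot_sup_eq] at h1

theorem IsBuilding.sup_split (hB : IsBuilding g r t) {m : ι} (hm : m ∈ fac g t) {x y : L}
    (hy : y ≤ cofac g t m) :
    ((fac g t).sup fun k => if k = m then x else y ⊓ g k) = x ⊔ y := by
  rw [← Finset.insert_erase hm, Finset.sup_insert, if_pos rfl]
  congr 1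
  rw [← hB.sup_erase_inf hm hy]
  refine Finset.sup_congr rfl fun k hk => ?_
  rw [if_neg (Finset.ne_of_mem_erase hk), hB.sup_erase_inf hm hy]

theorem IsBuilding.split_inf_fac (hB : IsBuilding g r t) {m : ι} (hm : m ∈ fac g t) {x y : L}
    (hx : x ≤ g m) (hy : y ≤ cofac g t m) : (x ⊔ y) ⊓ g m = x := by
  have h1 := hB.sup_inf_eq le_rfl (fun k => if k = m then x else y ⊓ g k)
    (fun k _ => by by_cases hk : k = m <;> simp [hk, hx]) hm
  rwa [hB.sup_split hm hy, if_pos rfl] at h1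

theorem IsBuilding.rk_split (hB : IsBuilding g r t) {m : ι} (hm : m ∈ fac g t) {x y : L}
    (hx : x ≤ g m) (hy : y ≤ cofac g t m) : r (x ⊔ y) = r x + r y := by
  have key : ∀ x ≤ g m, r (x ⊔ y) = r x + ∑ k ∈ (fac g t).erase m, r (y ⊓ g k) := fun x hx => by
    have h1 := hB.rk_sup le_rfl (fun k => if k = m then x else y ⊓ g k)
      (fun k _ => by by_cases hk : k = m <;> simp [hk, hx])
    rw [hB.sup_split hm hy, ← Finset.add_sum_erase _ _ hm, if_pos rfl] at h1
    rw [h1]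
    congr 1
    refine Finset.sum_congr rfl fun k hk => ?_
    rw [if_neg (Finset.ne_of_mem_erase hk)]
  have h2 := key ⊥ bot_le
  rw [bot_sup_eq, hB.bot, zero_add] at h2
  rw [key x hx, h2]

/-- A larger second component would, by additivity of the rank, have a join with `x` of rank above
that of `x ⊔ y`, although the join lies below it. -/
theorem IsBuilding.split_inf_cofac (hB : IsBuilding g r t) {m : ι} (hm : m ∈ fac g t) {x y : L}
    (hx : x ≤ g m) (hy : y ≤ cofac g t m) : (x ⊔ y) ⊓ cofac g t m = y := by
  have h1 : y ≤ (x ⊔ y) ⊓ cofac g t m := le_inf le_sup_right hy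
  by_contra hne
  have h2 := hB.strictMono (lt_of_le_of_ne h1 (Ne.symm hne))
  have h3 := hB.rk_split hm hx (inf_le_right : (x ⊔ y) ⊓ cofac g t m ≤ _)
  have h4 := hB.strictMono.monotone (sup_le le_sup_left inf_le_left :
    x ⊔ (x ⊔ y) ⊓ cofac g t m ≤ x ⊔ y)
  rw [h3, hB.rk_split hm hx hy] at h4
  omega

theorem IsBuilding.inf_sup_inf (hB : IsBuilding g r t) (m : ι) {H : L} (hH : H ≤ t) : H ⊓ g m ⊔ H ⊓ cofac g t m = H := by
  apply le_antisymm (sup_le inf_le_left inf_le_left)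
  calc H = (fac g t).sup fun k => H ⊓ g k := (hB.sup_inf le_rfl hH).symm
    _ ≤ _ := Finset.sup_le fun k hk => by
      by_cases hkm : k = m
      · exact hkm ▸ le_sup_left
      · refine le_sup_of_le_right (inf_le_inf_left _ ?_)
        exact Finset.le_sup (f := g) (Finset.mem_erase.2 ⟨hkm, hk⟩)

theorem IsBuilding.fac_cofac (hB : IsBuilding g r t) {m : ι} (hm : m ∈ fac g t) :
    fac g (cofac g t m) = (fac g t).erase m := by
  ext i
  constructor
  · intro hi
    obtain ⟨h1, h2⟩ := mem_fac.1 hi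
    obtain ⟨k, hk, hik⟩ := exists_mem_fac (h1.trans cofac_le)
    have hkm : k ≠ m := by
      rintro rfl
      exact hB.ne_bot i (le_bot_iff.1 (hB.cofac_inf hm ▸ le_inf h1 (g.le_iff_le.2 hik)))
    have hk' := Finset.mem_erase.2 ⟨hkm, hk⟩
    rwa [← h2 k (Finset.le_sup (f := g) hk') hik]
  · intro hi
    obtain ⟨-, h1⟩ := Finset.mem_erase.1 hi
    exact mem_fac.2 ⟨Finset.le_sup (f := g) hi, fun j hj hij =>
      (mem_fac.1 h1).2 j (hj.trans cofac_le) hij⟩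

theorem IsBuilding.sum_split [Fintype L] {R : Type*} [AddCommMonoid R] (hB : IsBuilding g r t)
    {m : ι} (hm : m ∈ fac g t) {K : L} (hK : K ≤ t) (f : L → R) :
    ∑ H with K ≤ H ∧ H ≤ t, f H =
      ∑ y with K ⊓ cofac g t m ≤ y ∧ y ≤ cofac g t m, ∑ x with K ⊓ g m ≤ x ∧ x ≤ g m,
        f (x ⊔ y) := by
  rw [← Finset.sum_product']
  refine Finset.sum_nbij' (fun H => (H ⊓ cofac g t m, H ⊓ g m)) (fun p => p.2 ⊔ p.1)
    ?_ ?_ ?_ ?_ ?_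
  · intro H hH
    simp only [Finset.mem_filter, Finset.mem_univ, true_and, Finset.mem_product] at hH ⊢
    exact ⟨⟨inf_le_inf_right _ hH.1, inf_le_right⟩, inf_le_inf_right _ hH.1, inf_le_right⟩
  · rintro ⟨y, x⟩ h
    simp only [Finset.mem_filter, Finset.mem_univ, true_and, Finset.mem_product] at h ⊢
    refine ⟨?_, sup_le (h.2.2.trans (mem_fac.1 hm).1) (h.1.2.trans cofac_le)⟩
    rw [← hB.inf_sup_inf m hK]
    exact sup_le_sup h.2.1 h.1.1
  · intro H hH
    exact hB.inf_sup_inf m (Finset.mem_filter.1 hH).2.2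
  · rintro ⟨y, x⟩ h
    simp only [Finset.mem_filter, Finset.mem_univ, true_and, Finset.mem_product] at h
    simp only [hB.split_inf_fac hm h.2.2 h.1.2, hB.split_inf_cofac hm h.2.2 h.1.2]
  · intro H hH
    simp only [hB.inf_sup_inf m (Finset.mem_filter.1 hH).2.2]

end Split

/-! ### Generating functions and the convolution identity -/

section Identity

open scoped Classical
open Polynomial

variable {ι L : Type*} [Fintype ι] [PartialOrder ι] [Lattice L] [OrderBot L]
  {g : ι ↪o L} {r : L → ℕ} {t : L}

/-- The standard exponents supported below `F`. -/
noncomputable def stdBelow (g : ι ↪o L) (r : L → ℕ) (F : L) : Finset (ι → ℕ) :=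
  (stdSet g r).filter fun a => ∀ i, a i ≠ 0 → g i ≤ F

/-- The generating function of the standard exponents supported below `F`. -/
noncomputable def stdSeries (g : ι ↪o L) (r : L → ℕ) (F : L) : ℤ[X] :=
  ∑ a ∈ stdBelow g r F, X ^ ∑ i, a i

theorem mem_stdBelow {F : L} {a : ι → ℕ} :
    a ∈ stdBelow g r F ↔ IsStd g r a ∧ ∀ i, a i ≠ 0 → g i ≤ F := by
  rw [stdBelow, Finset.mem_filter, mem_stdSet]

theorem isStd_update {a : ι → ℕ} (ha : IsStd g r a) {m : ι} (hm : IsMax m) {k : ℕ}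
    (hk : k + r (subJoin g a m) < r (g m)) : IsStd g r (Function.update a m k) := by
  intro i
  rw [subJoin_congr (b := a)]
  · by_cases hi : i = m
    · subst hi
      simpa using hk
    · simpa [hi] using ha i
  · intro j hj
    have : j ≠ m := by
      rintro rfl
      exact hj.not_ge (hm hj.le)
    simp [this]

theorem sum_update_add (a : ι → ℕ) (m : ι) (k : ℕ) :
    ∑ i, Function.update a m k i + a m = ∑ i, a i + k := by
  rw [Finset.sum_update_of_mem (Finset.mem_univ m),
    ← Finset.add_sum_erase _ a (Finset.mem_univ m), Finset.sdiff_singleton_eq_erase]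
  ring

/-- Since `m` is maximal, its exponent ranges freely over `0, …, gap - 1` once the others are fixed.
The cyclic shift lowering `a m` by one and sending `0` to `gap - 1` matches the exponents on the two
sides. -/
theorem sum_stdBelow_top {m : ι} (hm : IsMax m) {F : L} (hF : g m ≤ F) :
    ∑ a ∈ stdBelow g r F, (X : ℤ[X]) ^ (∑ i, a i + if a m = 0 then gap g r a m else 0) =
      X * stdSeries g r F := by
  have hsub : ∀ (a : ι → ℕ) k, subJoin g (Function.update a m k) m = subJoin g a m :=
    fun a k => subJoin_congr fun j hj => by simp [hj.ne]
  have hmem : ∀ a ∈ stdBelow g r F, ∀ k, k < gap g r a m →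
      Function.update a m k ∈ stdBelow g r F := fun a ha k hk => by
    obtain ⟨h1, h2⟩ := mem_stdBelow.1 ha
    refine mem_stdBelow.2 ⟨isStd_update h1 hm ?_, fun i hi => ?_⟩
    · unfold gap at hk
      omega
    · by_cases him : i = m
      · exact him ▸ hF
      · exact h2 i (by simpa [him] using hi)
  have hlt : ∀ a ∈ stdBelow g r F, a m < gap g r a m := fun a ha => by
    have := (mem_stdBelow.1 ha).1 m
    unfold gap
    omega
  have hgap : ∀ (a : ι → ℕ) k, gap g r (Function.update a m k) m = gap g r a m := fun a k => by
    rw [gap, hsub, gap]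
  rw [stdSeries, Finset.mul_sum]
  refine Finset.sum_nbij'
    (fun a => Function.update a m (if a m = 0 then gap g r a m - 1 else a m - 1))
    (fun a => Function.update a m (if a m + 1 = gap g r a m then 0 else a m + 1)) ?_ ?_ ?_ ?_ ?_
  · intro a ha
    have := hlt a ha
    refine hmem a ha _ ?_
    split_ifs <;> omega
  · intro a ha
    have := hlt a ha
    refine hmem a ha _ ?_
    split_ifs <;> omega
  · intro a ha
    have := hlt a ha
    simp only [hgap, Function.update_self, Function.update_idem]
    refine (congrArg (Function.update a m) ?_).trans (Function.update_eq_self m a)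
    by_cases h0 : a m = 0
    · rw [if_pos h0, if_pos (by omega), h0]
    · rw [if_neg h0, if_neg (by omega)]
      omega
  · intro a ha
    have := hlt a ha
    simp only [hgap, Function.update_self, Function.update_idem]
    refine (congrArg (Function.update a m) ?_).trans (Function.update_eq_self m a)
    by_cases h0 : a m + 1 = gap g r a m
    · rw [if_pos h0, if_pos rfl]
      omega
    · rw [if_neg h0, if_neg (by omega)]
      omega
  · intro a ha
    have := hlt a ha
    have h1 := sum_update_add a m (if a m = 0 then gap g r a m - 1 else a m - 1)
    rw [← pow_succ']
    congr 1
    by_cases h0 : a m = 0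
    · simp only [h0, if_true] at h1 ⊢
      omega
    · simp only [h0, if_false] at h1 ⊢
      omega

variable [Fintype L] {chi : L → L → ℤ[X]}

/-- The defining property of the characteristic polynomials of intervals. -/
def IsCharFun (r : L → ℕ) (chi : L → L → ℤ[X]) : Prop :=
  ∀ K G, K ≤ G → ∑ H with K ≤ H ∧ H ≤ G, chi H G = X ^ (r G - r K)

/-- Möbius inversion in the form of uniqueness, by downward induction from `t`. Identities for
characteristic polynomials are checked on interval sums through it. -/
theorem eq_of_sum_interval_eq {R : Type*} [AddCommGroup R] {f f' : L → R}
    (h : ∀ K ≤ t, ∑ H with K ≤ H ∧ H ≤ t, f H = ∑ H with K ≤ H ∧ H ≤ t, f' H) :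
    ∀ K ≤ t, f K = f' K := by
  intro K
  induction K using WellFoundedGT.induction with
  | _ K ih =>
    intro hK
    have h1 := h K hK
    have hmem : K ∈ Finset.univ.filter fun H => K ≤ H ∧ H ≤ t := by simp [hK]
    rw [← Finset.add_sum_erase _ _ hmem, ← Finset.add_sum_erase _ _ hmem] at h1
    rw [Finset.sum_congr rfl (g := f')] at h1
    · exact add_right_cancel h1
    · intro H hH
      obtain ⟨h2, h3⟩ := Finset.mem_erase.1 hH
      obtain ⟨h4, h5⟩ := (Finset.mem_filter.1 h3).2
      exact ih H (lt_of_le_of_ne h4 h2.symm) h5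

theorem IsCharFun.self (hchi : IsCharFun r chi) (G : L) : chi G G = 1 := by
  have h1 := hchi G G le_rfl
  have h2 : (Finset.univ.filter fun H => G ≤ H ∧ H ≤ G) = {G} := by
    ext H
    simp [le_antisymm_iff, and_comm]
  rwa [h2, Finset.sum_singleton, Nat.sub_self, pow_zero] at h1

/-- At `X = 1` all interval sums equal one, exactly as for the indicator of `G`, so the value at one
vanishes below `G`. -/
theorem IsCharFun.dvd_of_lt (hchi : IsCharFun r chi) {x G : L} (hx : x < G) :
    (1 - X) ∣ chi x G := by
  have h1 := eq_of_sum_interval_eq (t := G) (f := fun H => (chi H G).eval 1)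
    (f' := fun H => if H = G then 1 else 0) (fun K hK => by
      rw [← eval_finsetSum, hchi K G hK, Finset.sum_ite_eq', if_pos (by simp [hK])]
      simp) x hx.le
  simp only [hx.ne, if_false] at h1
  have h2 : (X - C 1) ∣ chi x G := dvd_iff_isRoot.2 h1
  rw [← neg_sub, neg_dvd]
  simpa using h2

/-- The interval is a product and ranks add, so both sides have the same interval sums. -/
theorem IsBuilding.chi_split (hB : IsBuilding g r t) (hchi : IsCharFun r chi) {m : ι}
    (hm : m ∈ fac g t) : ∀ F ≤ t, chi F t =
      chi (F ⊓ g m) (g m) * chi (F ⊓ cofac g t m) (cofac g t m) := by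
  refine eq_of_sum_interval_eq fun K hK => ?_
  rw [hchi K t hK, hB.sum_split hm hK]
  have h1 : ∀ y ∈ Finset.univ.filter fun y => K ⊓ cofac g t m ≤ y ∧ y ≤ cofac g t m,
      (∑ x with K ⊓ g m ≤ x ∧ x ≤ g m, chi ((x ⊔ y) ⊓ g m) (g m) *
        chi ((x ⊔ y) ⊓ cofac g t m) (cofac g t m)) =
      X ^ (r (g m) - r (K ⊓ g m)) * chi y (cofac g t m) := fun y hy => by
    have hy := (Finset.mem_filter.1 hy).2
    rw [← hchi _ _ (inf_le_right : K ⊓ g m ≤ g m), Finset.sum_mul]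
    refine Finset.sum_congr rfl fun x hx => ?_
    have hx := (Finset.mem_filter.1 hx).2
    rw [hB.split_inf_fac hm hx.2 hy.2, hB.split_inf_cofac hm hx.2 hy.2]
  rw [Finset.sum_congr rfl h1, ← Finset.mul_sum, hchi _ _ inf_le_right, ← pow_add]
  congr 1
  have h2 := hB.rk_split hm (inf_le_right : K ⊓ g m ≤ g m)
    (inf_le_right : K ⊓ cofac g t m ≤ cofac g t m)
  have h3 := hB.rk_split hm (inf_le_right : t ⊓ g m ≤ g m)
    (inf_le_right : t ⊓ cofac g t m ≤ cofac g t m)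
  rw [hB.inf_sup_inf m hK] at h2
  rw [hB.inf_sup_inf m le_rfl, inf_eq_right.2 (mem_fac.1 hm).1, inf_eq_right.2 cofac_le] at h3
  have h4 := hB.strictMono.monotone (inf_le_right : K ⊓ g m ≤ g m)
  have h5 := hB.strictMono.monotone (inf_le_right : K ⊓ cofac g t m ≤ cofac g t m)
  omega

/-- The number of factors of `t` not below `F`. -/
noncomputable def facCount (g : ι ↪o L) (F t : L) : ℕ :=
  ((fac g t).filter fun i => ¬ g i ≤ F).card

theorem IsBuilding.facCount_split (hB : IsBuilding g r t) {m : ι} (hm : m ∈ fac g t) (F : L) :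
    facCount g F t = (if g m ≤ F then 0 else 1) +
      facCount g (F ⊓ cofac g t m) (cofac g t m) := by
  have h1 : ((fac g t).erase m).filter (fun i => ¬ g i ≤ F) =
      ((fac g t).erase m).filter (fun i => ¬ g i ≤ F ⊓ cofac g t m) := by
    refine Finset.filter_congr fun i hi => ?_
    have : g i ≤ cofac g t m := Finset.le_sup (f := g) hi
    rw [le_inf_iff, and_iff_left this]
  unfold facCount
  rw [hB.fac_cofac hm, ← h1]
  nth_rw 1 [← Finset.insert_erase hm]
  rw [Finset.filter_insert]
  by_cases h : g m ≤ F
  · rw [if_neg (not_not.2 h), if_pos h, zero_add]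
  · rw [if_pos h, if_neg h, Finset.card_insert_of_notMem (by simp), add_comm]

theorem IsBuilding.pow_dvd_chi (hB : IsBuilding g r t) (hchi : IsCharFun r chi) {F : L}
    (hF : F ≤ t) : (1 - X) ^ facCount g F t ∣ chi F t := by
  induction hn : (fac g t).card generalizing t F with
  | zero =>
    have : facCount g F t = 0 := by
      rw [facCount, Finset.card_eq_zero.1 hn]
      simp
    simp [this]
  | succ n ih =>
    obtain ⟨m, hm⟩ := Finset.card_pos.1 (by omega : 0 < (fac g t).card)
    rw [hB.chi_split hchi hm F hF, hB.facCount_split hm, pow_add]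
    refine mul_dvd_mul ?_ (ih (hB.mono cofac_le) inf_le_right ?_)
    · split_ifs with h
      · simp
      · rw [pow_one]
        refine hchi.dvd_of_lt (lt_of_le_of_ne inf_le_right fun h' => h ?_)
        exact inf_eq_right.1 h'
    · rw [hB.fac_cofac hm, Finset.card_erase_of_mem hm, hn, Nat.add_sub_cancel]

/-- For fixed `a`, the admissible `x` form the interval from `J a` to `g m`, over which the
characteristic polynomials sum to a single power of `X`. The rotation of `sum_stdBelow_top` then
evaluates the sum over `a`. -/
theorem IsBuilding.sum_stdSeries_mul_chi (hB : IsBuilding g r t) (ht : ∀ i, g i ≤ t)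
    (hchi : IsCharFun r chi) {m : ι} (hm : m ∈ fac g t) {y : L} (hy : y ≤ cofac g t m) :
    ∑ x with x ≤ g m, stdSeries g r (x ⊔ y) * chi x (g m) = X * stdSeries g r (g m ⊔ y) := by
  have hmax : IsMax m := fun k hk => ((mem_fac.1 hm).2 k (ht k) hk).le
  rw [← sum_stdBelow_top hmax le_sup_left]
  set J : (ι → ℕ) → L := fun a => (Finset.univ.filter fun i => i ≤ m ∧ a i ≠ 0).sup g with hJ
  have hJle : ∀ a, J a ≤ g m := fun a =>
    Finset.sup_le fun i hi => g.le_iff_le.2 (Finset.mem_filter.1 hi).2.1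
  have h1 : ∀ x ∈ Finset.univ.filter fun x => x ≤ g m,
      -- A member below `g m` is tested against the component `x` only, and any other member against
      -- `y` only.
      stdBelow g r (x ⊔ y) = (stdBelow g r (g m ⊔ y)).filter fun a => J a ≤ x := fun x hx => by
    have hx := (Finset.mem_filter.1 hx).2
    ext a
    rw [Finset.mem_filter, mem_stdBelow, mem_stdBelow]
    constructor
    · rintro ⟨h1, h2⟩
      refine ⟨⟨h1, fun i hi => (h2 i hi).trans (sup_le_sup_right hx _)⟩,
        Finset.sup_le fun i hi => ?_⟩
      obtain ⟨him, hi0⟩ := (Finset.mem_filter.1 hi).2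
      rw [← hB.split_inf_fac hm hx hy]
      exact le_inf (h2 i hi0) (g.le_iff_le.2 him)
    · rintro ⟨⟨h1, h2⟩, h3⟩
      refine ⟨h1, fun i hi => ?_⟩
      obtain ⟨k, hk, hik⟩ := exists_mem_fac (ht i)
      by_cases hkm : k = m
      · refine le_sup_of_le_left (le_trans ?_ h3)
        exact Finset.le_sup (f := g) (Finset.mem_filter.2 ⟨Finset.mem_univ _, hkm ▸ hik, hi⟩)
      · refine le_sup_of_le_right ?_
        rw [← hB.split_inf_cofac hm le_rfl hy]
        refine le_inf (h2 i hi) ((g.le_iff_le.2 hik).trans ?_)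
        exact Finset.le_sup (f := g) (Finset.mem_erase.2 ⟨hkm, hk⟩)
  have h2 : ∑ x with x ≤ g m, stdSeries g r (x ⊔ y) * chi x (g m) =
      ∑ x with x ≤ g m, ∑ a ∈ stdBelow g r (g m ⊔ y),
        if J a ≤ x then X ^ (∑ i, a i) * chi x (g m) else 0 := by
    refine Finset.sum_congr rfl fun x hx => ?_
    rw [stdSeries, h1 x hx, Finset.sum_mul, Finset.sum_filter]
  rw [h2, Finset.sum_comm]
  refine Finset.sum_congr rfl fun a ha => ?_
  have ha := mem_stdBelow.1 ha
  rw [← Finset.sum_filter, Finset.filter_filter, ← Finset.mul_sum]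
  have h3 : (Finset.univ.filter fun x => x ≤ g m ∧ J a ≤ x) =
      Finset.univ.filter fun x => J a ≤ x ∧ x ≤ g m := Finset.filter_congr fun _ _ => and_comm
  rw [h3, hchi _ _ (hJle a), ← pow_add]
  congr 2
  -- If `a m = 0`, then `J a` is the join strictly below `m` and the excess is the gap. Otherwise `J
  -- a = g m` and there is no excess.
  split_ifs with h0
  · have : J a = subJoin g a m := by
      rw [hJ, subJoin]
      refine congrArg (fun s => Finset.sup s g) ?_
      ext i
      simp only [Finset.mem_filter, Finset.mem_univ, true_and, le_iff_lt_or_eq]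
      constructor
      · rintro ⟨h | rfl, h'⟩
        · exact ⟨h, h'⟩
        · exact absurd h0 h'
      · exact fun h => ⟨Or.inl h.1, h.2⟩
    rw [this, gap]
  · have : J a = g m := le_antisymm (hJle a)
      (Finset.le_sup (f := g) (Finset.mem_filter.2 ⟨Finset.mem_univ _, le_rfl, h0⟩))
    rw [this, Nat.sub_self]

/-- The convolution of the Hilbert series with the reduced characteristic function vanishes. -/
theorem IsBuilding.sum_stdSeries_mul_eq_zero (hB : IsBuilding g r t) (ht : ∀ i, g i ≤ t)
    (hbot : t ≠ ⊥) (hchi : IsCharFun r chi) {c : L → ℤ[X]}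
    (hc : ∀ F ≤ t, (1 - X) ^ facCount g F t * c F = chi F t) :
    ∑ F with F ≤ t, stdSeries g r F * c F = 0 := by
  have h0 : (fac g t).Nonempty := by
    rw [Finset.nonempty_iff_ne_empty]
    intro h
    have := hB.sup_fac le_rfl
    rw [h, Finset.sup_empty] at this
    exact hbot this.symm
  obtain ⟨m, hm⟩ := h0
  have h1 := hB.sum_split hm (bot_le : ⊥ ≤ t) fun F => stdSeries g r F * c F
  simp only [bot_le, true_and, bot_inf_eq] at h1
  rw [h1]
  refine Finset.sum_eq_zero fun y hy => ?_
  have hy := (Finset.mem_filter.1 hy).2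
  set k := facCount g y (cofac g t m) with hk
  have hne : ((1 : ℤ[X]) - X) ^ (k + 1) ≠ 0 := pow_ne_zero _ fun h => by
    have := congr_arg (eval 0) h
    simp at this
  refine (mul_eq_zero.1 (?_ : (1 - X : ℤ[X]) ^ (k + 1) * _ = 0)).resolve_left hne
  rw [Finset.mul_sum]
  -- For `x ≠ g m` the power `k + 1` clears the denominator exactly. For `x = g m` one factor `1 -
  -- X` is left over, and its `-X` part is the correction term.
  have h2 : ∀ x ∈ Finset.univ.filter fun x => x ≤ g m,
      (1 - X : ℤ[X]) ^ (k + 1) * (stdSeries g r (x ⊔ y) * c (x ⊔ y)) =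
      chi y (cofac g t m) * (stdSeries g r (x ⊔ y) * chi x (g m) -
        if x = g m then X * stdSeries g r (g m ⊔ y) else 0) := fun x hx => by
    have hx := (Finset.mem_filter.1 hx).2
    have hle : x ⊔ y ≤ t := sup_le (hx.trans (mem_fac.1 hm).1) (hy.trans cofac_le)
    have h3 := hc _ hle
    rw [hB.chi_split hchi hm _ hle, hB.facCount_split hm, hB.split_inf_fac hm hx hy,
      hB.split_inf_cofac hm hx hy, ← hk] at h3
    by_cases hxm : x = g m
    · subst hxm
      rw [if_pos le_sup_left, zero_add, hchi.self] at h3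
      rw [if_pos rfl, hchi.self, pow_succ]
      linear_combination (1 - X) * stdSeries g r (g m ⊔ y) * h3
    · have h4 : ¬ g m ≤ x ⊔ y := fun h => hxm <| by
        rw [← hB.split_inf_fac hm hx hy]
        exact inf_eq_right.2 h
      rw [if_neg h4] at h3
      rw [if_neg hxm, add_comm k]
      linear_combination stdSeries g r (x ⊔ y) * h3
  rw [Finset.sum_congr rfl h2, ← Finset.mul_sum, Finset.sum_sub_distrib,
    hB.sum_stdSeries_mul_chi ht hchi hm hy, Finset.sum_ite_eq', if_pos (by simp), sub_self,
    mul_zero]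

end Identity

end BuildingSet

namespace BuildingSet

/-! ### Building sets above a fixed element -/

section Contraction

open scoped Classical

variable {ι ι' L : Type*} [Fintype ι] [PartialOrder ι] [Fintype ι'] [PartialOrder ι']
  [Lattice L] [OrderBot L] {g : ι ↪o L} {r : L → ℕ} {t b : L} {g' : ι' ↪o Set.Ici b}

theorem IsRank.contract (hr : IsRank r) (b : L) :
    IsRank fun x : Set.Ici b => r x.1 - r b where
  bot := Nat.sub_self _
  strictMono x y hxy := by
    have h1 := hr.strictMono.monotone x.2
    have h2 := hr.strictMono (show x.1 < y.1 from hxy)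
    change r x.1 - r b < r y.1 - r b
    omega
  submod x y := by
    have h1 := hr.strictMono.monotone x.2
    have h2 := hr.strictMono.monotone y.2
    have h3 := hr.strictMono.monotone (x ⊓ y).2
    have h4 := hr.submod x.1 y.1
    have h5 : r b ≤ r (x ⊔ y).1 := hr.strictMono.monotone (x ⊔ y).2
    change r (x ⊔ y).1 - r b + (r (x ⊓ y).1 - r b) ≤ r x.1 - r b + (r y.1 - r b)
    change r (x ⊔ y).1 + r (x ⊓ y).1 ≤ _ at h4
    omega

/-- This gives the coordinates of `g i ⊔ b` in the product below `F`: all of `g i` at `i`, and those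
of `b` elsewhere. The contraction lemmas read meets and ranks off these coordinates. -/
theorem IsBuilding.sup_contract (hB : IsBuilding g r t) {F : L} (hF : F ≤ t) (hb : b ≤ F) {i : ι}
    (hi : i ∈ fac g F) : ((fac g F).sup fun k => if k = i then g i else b ⊓ g k) = g i ⊔ b := by
  apply le_antisymm
  · refine Finset.sup_le fun k _ => ?_
    split_ifs
    · exact le_sup_left
    · exact le_sup_of_le_right inf_le_left
  · refine sup_le ?_ ?_
    · have := Finset.le_sup (f := fun k => if k = i then g i else b ⊓ g k) hi
      simpa using this
    · calc b = (fac g F).sup fun k => b ⊓ g k := (hB.sup_inf hF hb).symm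
        _ ≤ _ := Finset.sup_mono_fun fun k _ => by
          split_ifs with h
          · exact h ▸ inf_le_right
          · exact le_rfl

theorem IsBuilding.sup_inf_contract (hB : IsBuilding g r t) {F : L} (hF : F ≤ t) (hb : b ≤ F)
    {i k : ι} (hi : i ∈ fac g F) (hk : k ∈ fac g F) (hki : k ≠ i) :
    (g i ⊔ b) ⊓ g k = b ⊓ g k := by
  have h1 := hB.sup_inf_eq hF (fun k => if k = i then g i else b ⊓ g k)
    (fun k _ => by by_cases hk : k = i <;> simp [hk]) hk
  rwa [hB.sup_contract hF hb hi, if_neg hki] at h1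

theorem IsBuilding.rk_sup_contract (hB : IsBuilding g r t) {F : L} (hF : F ≤ t) (hb : b ≤ F)
    {i : ι} (hi : i ∈ fac g F) : r (g i ⊔ b) + r (b ⊓ g i) = r (g i) + r b := by
  have h1 := hB.rk_sup hF (fun k => if k = i then g i else b ⊓ g k)
    (fun k _ => by by_cases hk : k = i <;> simp [hk])
  have h2 := hB.rk_sup hF (fun k => b ⊓ g k) fun _ _ => inf_le_right
  rw [hB.sup_contract hF hb hi, ← Finset.add_sum_erase _ _ hi, if_pos rfl] at h1
  rw [hB.sup_inf hF hb, ← Finset.add_sum_erase _ _ hi] at h2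
  have h3 : ∑ k ∈ (fac g F).erase i, r (if k = i then g i else b ⊓ g k) =
      ∑ k ∈ (fac g F).erase i, r (b ⊓ g k) :=
    Finset.sum_congr rfl fun k hk => by rw [if_neg (Finset.ne_of_mem_erase hk)]
  omega

/-- The family `g'` consists of the joins with `b` of the members of `g` below `t` and not
below `b`. -/
def IsContraction (g : ι ↪o L) (t : L) (g' : ι' ↪o Set.Ici b) : Prop :=
  ∀ x : Set.Ici b, (∃ i, g' i = x) ↔ ∃ i, g i ≤ t ∧ ¬ g i ≤ b ∧ g i ⊔ b = x.1

/-- The join with `b`, as an element above `b`. -/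
def joinBase (b x : L) : Set.Ici b := ⟨x ⊔ b, le_sup_right⟩

theorem IsBuilding.joinBase_injOn (hB : IsBuilding g r t) {F : L} (hF : F ≤ t) (hb : b ≤ F) :
    Set.InjOn (fun i => joinBase b (g i)) ((fac g F).filter fun i => ¬ g i ≤ b) := by
  intro i hi k hk hik
  obtain ⟨hi, hi'⟩ := Finset.mem_filter.1 hi
  obtain ⟨hk, hk'⟩ := Finset.mem_filter.1 hk
  have h1 : g i ⊔ b = g k ⊔ b := congrArg Subtype.val hik
  by_contra hne
  have h2 := hB.sup_inf_contract hF hb hi hk (Ne.symm hne)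
  rw [h1, inf_eq_right.2 le_sup_left] at h2
  exact hk' (h2 ▸ inf_le_left)

/-- Factors not below `b` stay incomparable after joining with `b`, since the join leaves the other
coordinates equal to those of `b`. Every other joined member lies under one of these. -/
theorem IsBuilding.fac_contract (hB : IsBuilding g r t) (hg' : IsContraction g t g')
    {F : Set.Ici b} (hF : F.1 ≤ t) : (fac g' F).map g'.toEmbedding =
      ((fac g F.1).filter fun i => ¬ g i ≤ b).image fun i => joinBase b (g i) := by
  have hb : b ≤ F.1 := F.2
  have key : ∀ i ∈ fac g F.1, ∀ k ∈ fac g F.1, ¬ g i ≤ b → g i ⊔ b ≤ g k ⊔ b → i = k := by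
    intro i hi k hk hib hik
    by_contra hne
    have h2 := hB.sup_inf_contract hF hb hk hi hne
    rw [inf_eq_right.2 (le_sup_left.trans hik)] at h2
    exact hib (h2 ▸ inf_le_left)
  ext x
  simp only [Finset.mem_map, Finset.mem_image, Finset.mem_filter, RelEmbedding.coe_toEmbedding]
  constructor
  · rintro ⟨i', hi', rfl⟩
    obtain ⟨h1, h2⟩ := mem_fac.1 hi'
    obtain ⟨j, hjt, hjb, hj⟩ := (hg' (g' i')).1 ⟨i', rfl⟩
    have hjF : g j ≤ F.1 := le_sup_left.trans (hj.le.trans h1)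
    obtain ⟨k, hk, hjk⟩ := exists_mem_fac hjF
    have hkF := (mem_fac.1 hk).1
    have hkb : ¬ g k ≤ b := fun h => hjb ((g.le_iff_le.2 hjk).trans h)
    obtain ⟨k', hk'⟩ := (hg' (joinBase b (g k))).2 ⟨k, hkF.trans hF, hkb, rfl⟩
    refine ⟨k, ⟨hk, hkb⟩, ?_⟩
    rw [← hk', h2 k']
    · rw [hk']
      exact sup_le hkF hb
    · rw [← g'.le_iff_le, hk']
      change (g' i').1 ≤ g k ⊔ b
      rw [← hj]
      exact sup_le_sup_right (g.le_iff_le.2 hjk) _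
  · rintro ⟨i, ⟨hi, hib⟩, rfl⟩
    have hiF := (mem_fac.1 hi).1
    obtain ⟨i', hi'⟩ := (hg' (joinBase b (g i))).2 ⟨i, hiF.trans hF, hib, rfl⟩
    refine ⟨i', mem_fac.2 ⟨?_, fun j' hj' hij' => ?_⟩, hi'⟩
    · rw [hi']
      exact sup_le hiF hb
    · obtain ⟨j, hjt, hjb, hj⟩ := (hg' (g' j')).1 ⟨j', rfl⟩
      obtain ⟨k, hk, hjk⟩ := exists_mem_fac (le_sup_left.trans (hj.le.trans hj') : g j ≤ F.1)
      have h3 : g j ⊔ b ≤ g k ⊔ b := sup_le_sup_right (g.le_iff_le.2 hjk) _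
      have h4 : g i ⊔ b ≤ g j ⊔ b := by
        have : (g' i').1 ≤ (g' j').1 := g'.le_iff_le.2 hij'
        rwa [hi', ← hj] at this
      obtain rfl := key i hi k hk hib (h4.trans h3)
      apply g'.injective
      rw [hi']
      exact Subtype.ext (hj.symm.trans (le_antisymm h3 h4))

theorem IsBuilding.contract (hB : IsBuilding g r t) (hg' : IsContraction g t g') (hb : b ≤ t) :
    IsBuilding g' (fun x => r x.1 - r b) ⟨t, hb⟩ where
  toIsRank := hB.toIsRank.contract b
  ne_bot i h := by
    obtain ⟨j, _, hjb, hj⟩ := (hg' (g' i)).1 ⟨i, rfl⟩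
    rw [h] at hj
    exact hjb (le_sup_left.trans hj.le)
  decomp F hF K hK := by
    have hF' : F.1 ≤ t := hF
    set R : Set.Ici b := (fac g' F).sup fun i => K ⊓ g' i with hR
    change K.1 ≤ R.1
    refine (hB.decomp F.1 hF' K.1 hK).trans (Finset.sup_le fun k hk => ?_)
    by_cases hkb : g k ≤ b
    · exact inf_le_right.trans (hkb.trans R.2)
    · have h1 : joinBase b (g k) ∈ (fac g' F).map g'.toEmbedding := by
        rw [hB.fac_contract hg' hF']
        exact Finset.mem_image.2 ⟨k, Finset.mem_filter.2 ⟨hk, hkb⟩, rfl⟩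
      obtain ⟨k', hk', h2⟩ := Finset.mem_map.1 h1
      have h3 : K ⊓ g' k' ≤ R := Finset.le_sup (f := fun i => K ⊓ g' i) hk'
      have h4 : (g' k').1 = g k ⊔ b := congrArg Subtype.val h2
      have h5 : (K ⊓ g' k').1 = K.1 ⊓ (g k ⊔ b) := by rw [← h4]; rfl
      refine le_trans ?_ (show (K ⊓ g' k').1 ≤ R.1 from h3)
      rw [h5]
      exact inf_le_inf_left _ le_sup_left
  rk_eq F hF := by
    have hF' : F.1 ≤ t := hF
    have hbF : b ≤ F.1 := F.2
    have h1 : ∑ i ∈ fac g' F, (r (g' i).1 - r b) =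
        ∑ x ∈ (fac g' F).map g'.toEmbedding, (r x.1 - r b) := by
      rw [Finset.sum_map]
      rfl
    rw [h1, hB.fac_contract hg' hF', Finset.sum_image (hB.joinBase_injOn hF' hbF),
      Finset.sum_filter]
    -- Each factor's rank splits into a part over `b` and the rank of its meet with `b`; the meets
    -- sum to `r b`.
    have h2 : ∀ k ∈ fac g F.1, (if ¬ g k ≤ b then r (joinBase b (g k)).1 - r b else 0) +
        r (b ⊓ g k) = r (g k) := fun k hk => by
      have h3 := hB.rk_sup_contract hF' hbF hk
      have h4 : r b ≤ r (g k ⊔ b) := hB.strictMono.monotone le_sup_right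
      split_ifs with h
      · rw [inf_eq_right.2 h, zero_add]
      · change r (g k ⊔ b) - r b + _ = _
        omega
    have h3 := Finset.sum_congr rfl h2
    rw [Finset.sum_add_distrib, ← hB.rk_eq F.1 hF', ← hB.rk_sup hF' _ fun _ _ => inf_le_right,
      hB.sup_inf hF' hbF] at h3
    omega

theorem IsBuilding.facCount_contract (hB : IsBuilding g r t) (hg' : IsContraction g t g')
    (hb : b ≤ t) (H : Set.Ici b) : facCount g' H ⟨t, hb⟩ = facCount g H.1 t := by
  have h1 : facCount g' H ⟨t, hb⟩ =
      (((fac g' ⟨t, hb⟩).map g'.toEmbedding).filter fun x => ¬ x ≤ H).card := by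
    rw [Finset.filter_map, Finset.card_map]
    rfl
  have h2 := hB.fac_contract hg' (F := ⟨t, hb⟩) le_rfl
  rw [h1, h2, Finset.filter_image, Finset.card_image_of_injOn, Finset.filter_filter]
  · unfold facCount
    congr 1
    refine Finset.filter_congr fun i _ => ?_
    have h3 : joinBase b (g i) ≤ H ↔ g i ≤ H.1 := by
      change g i ⊔ b ≤ H.1 ↔ _
      have hbH : b ≤ H.1 := H.2
      rw [sup_le_iff, and_iff_left hbH]
    rw [h3]
    exact ⟨fun h => h.2, fun h => ⟨fun h' => h (h'.trans H.2), h⟩⟩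
  · exact (hB.joinBase_injOn le_rfl hb).mono (by
      intro i hi
      exact (Finset.mem_filter.1 hi).1)

end Contraction

/-! ### Standard exponents of a restricted family -/

section Restriction

open scoped Classical
open Polynomial

variable {ι ι' L : Type*} [Fintype ι] [PartialOrder ι] [Fintype ι'] [PartialOrder ι']
  [Lattice L] [OrderBot L] {g : ι ↪o L} {r : L → ℕ} {F : L} {g' : ι' ↪o L} {j : ι' → ι}

theorem subJoin_comp (hj : ∀ i, g (j i) = g' i) (hF : ∀ k, g k ≤ F ↔ ∃ i, j i = k)
    {a : ι → ℕ} (i : ι') : subJoin g' (a ∘ j) i = subJoin g a (j i) := by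
  have hle : ∀ i i', j i < j i' ↔ i < i' := fun i i' => by
    rw [← g.lt_iff_lt, hj, hj, g'.lt_iff_lt]
  apply le_antisymm
  · refine Finset.sup_le fun i' hi' => ?_
    obtain ⟨h1, h2⟩ := (Finset.mem_filter.1 hi').2
    rw [← hj]
    exact Finset.le_sup (f := g) (Finset.mem_filter.2 ⟨Finset.mem_univ _, (hle _ _).2 h1, h2⟩)
  · refine Finset.sup_le fun k hk => ?_
    obtain ⟨h1, h2⟩ := (Finset.mem_filter.1 hk).2
    obtain ⟨i', rfl⟩ := (hF k).1 ((g.le_iff_le.2 h1.le).trans ((hF _).2 ⟨i, rfl⟩))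
    rw [hj]
    exact Finset.le_sup (f := g') (Finset.mem_filter.2 ⟨Finset.mem_univ _, (hle _ _).1 h1, h2⟩)

/-- The generating function of the standard exponents of a restriction. -/
theorem sum_stdSet_restrict (hr : IsRank r) (hj : ∀ i, g (j i) = g' i)
    (hF : ∀ k, g k ≤ F ↔ ∃ i, j i = k) :
    ∑ a ∈ stdSet g' r, (X : ℤ[X]) ^ ∑ i, a i = stdSeries g r F := by
  have hinj : Function.Injective j := fun i i' h => g'.injective (by rw [← hj, ← hj, h])
  have hsupp : ∀ a ∈ stdBelow g r F, ∀ k, k ∉ Set.range j → a k = 0 := fun a ha k hk => by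
    by_contra h
    exact hk ((hF k).1 ((mem_stdBelow.1 ha).2 k h))
  symm
  refine Finset.sum_nbij' (fun a => a ∘ j) (fun a => Function.extend j a 0) ?_ ?_ ?_ ?_ ?_
  · intro a ha
    refine mem_stdSet.2 fun i => ?_
    rw [subJoin_comp hj hF, ← hj]
    exact (mem_stdBelow.1 ha).1 (j i)
  · intro a ha
    have ha := mem_stdSet.1 ha
    have hcomp : Function.extend j a 0 ∘ j = a := by
      ext i
      exact hinj.extend_apply _ _ _
    have h0 : ∀ k, (¬ ∃ i, j i = k) → Function.extend j a 0 k = 0 := fun k hk => by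
      rw [Function.extend_apply' _ _ _ hk]
      rfl
    have h1 : ∀ k, Function.extend j a 0 k ≠ 0 → g k ≤ F := fun k hk => by
      rw [hF]
      by_contra h
      exact hk (h0 k h)
    refine mem_stdBelow.2 ⟨fun k => ?_, h1⟩
    by_cases hk : ∃ i, j i = k
    · obtain ⟨i, rfl⟩ := hk
      rw [← subJoin_comp hj hF, hcomp, hinj.extend_apply, hj]
      exact ha i
    · rw [h0 k hk, zero_add]
      apply hr.strictMono
      -- Extension by zero imposes no new condition: at a member not below `F` the exponent is zero,
      -- and the support below it joins to something strictly smaller.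
      have h2 : subJoin g (Function.extend j a 0) k ≤ g k ⊓ F := by
        refine Finset.sup_le fun l hl => ?_
        obtain ⟨h3, h4⟩ := (Finset.mem_filter.1 hl).2
        exact le_inf (g.le_iff_le.2 h3.le) (h1 l h4)
      refine lt_of_le_of_ne (h2.trans inf_le_left) fun h => hk ((hF k).1 ?_)
      exact h ▸ h2.trans inf_le_right
  · intro a ha
    ext k
    by_cases hk : ∃ i, j i = k
    · obtain ⟨i, rfl⟩ := hk
      exact hinj.extend_apply _ _ _
    · rw [Function.extend_apply' _ _ _ hk, hsupp a ha k hk]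
      rfl
  · intro a _
    ext i
    exact hinj.extend_apply _ _ _
  · intro a ha
    rw [Fintype.sum_of_injective j hinj (a ∘ j) a (hsupp a ha) fun _ => rfl]

theorem IsBuilding.stdSeries_bot {t : L} (hB : IsBuilding g r t) : stdSeries g r ⊥ = 1 := by
  have h1 : stdBelow g r ⊥ = {0} := by
    ext a
    rw [mem_stdBelow, Finset.mem_singleton]
    constructor
    · rintro ⟨_, h⟩
      ext i
      by_contra hi
      exact hB.ne_bot i (le_bot_iff.1 (h i hi))
    · rintro rfl
      refine ⟨fun i => ?_, fun i hi => absurd rfl hi⟩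
      have h2 : subJoin g (0 : ι → ℕ) i = ⊥ := by simp [subJoin]
      rw [h2, hB.bot, Pi.zero_apply]
      have := hB.strictMono (bot_lt_iff_ne_bot.2 (hB.ne_bot i))
      omega
  rw [stdSeries, h1]
  simp

end Restriction

end BuildingSet

/-! ### Möbius functions of convex subposets, and one-sided inverses -/

namespace IncidenceAlgebra

/-- The Möbius function is preserved by embeddings onto order-convex subsets. -/
theorem mu_apply_of_orderEmbedding {P Q R : Type*} [PartialOrder P] [PartialOrder Q] [Finite P]
    [LocallyFiniteOrder P] [LocallyFiniteOrder Q] [DecidableEq P] [DecidableEq Q] [Ring R]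
    (u : P ↪o Q) (hu : ∀ x y q, u x ≤ q → q ≤ u y → ∃ p, u p = q) (x y : P) :
    mu R (u x) (u y) = mu R x y := by
  induction y using WellFoundedLT.induction with
  | _ y ih =>
    rw [mu_apply, mu_apply]
    simp only [EmbeddingLike.apply_eq_iff_eq]
    congr 2
    symm
    refine Finset.sum_bij (fun p _ => u p) ?_ ?_ ?_ ?_
    · intro p hp
      simpa using hp
    · intro p _ q _ h
      exact u.injective h
    · intro q hq
      obtain ⟨h1, h2⟩ := Finset.mem_Ico.1 hq
      obtain ⟨p, rfl⟩ := hu x y q h1 h2.le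
      exact ⟨p, by simpa using hq, rfl⟩
    · intro p hp
      exact (ih p (Finset.mem_Ico.1 hp).2).symm

/-- For a finite poset the incidence algebra sits multiplicatively inside square matrices over a
commutative ring, where one-sided inverses are two-sided. -/
theorem mul_eq_one_comm_of_finite {P R : Type*} [PartialOrder P] [Fintype P]
    [LocallyFiniteOrder P] [DecidableEq P] [CommRing R] {a b : IncidenceAlgebra R P}
    (h : a * b = 1) : b * a = 1 := by
  have hmul : ∀ a b : IncidenceAlgebra R P,
      Matrix.of (fun x y => (a * b) x y) =
        (Matrix.of fun x y => a x y) * (Matrix.of fun x y => b x y) := fun a b => by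
    ext x y
    rw [Matrix.mul_apply, Matrix.of_apply, mul_apply]
    refine Finset.sum_subset (Finset.subset_univ _) fun z _ hz => ?_
    by_cases hxz : x ≤ z
    · have : ¬ z ≤ y := fun hzy => hz (Finset.mem_Icc.2 ⟨hxz, hzy⟩)
      simp [apply_eq_zero_of_not_le this]
    · simp [apply_eq_zero_of_not_le hxz]
  have hone : Matrix.of (fun x y => (1 : IncidenceAlgebra R P) x y) = 1 := by
    ext x y
    simp [Matrix.one_apply]
  have h1 := hmul a b
  rw [h, hone] at h1
  have h2 := hmul b a
  rw [mul_eq_one_comm.1 h1.symm, ← hone] at h2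
  ext x y
  exact congrFun (congrFun h2 x) y

end IncidenceAlgebra

namespace Polymatroid

/-! ### Flats, building sets and Chow rings of minors in the abstract setting -/

section Flats

variable {α : Type*} [DecidableEq α] (M : Polymatroid α)

theorem rk_closure {A : Finset α} (hA : A ⊆ M.E) : M.rk (M.closure A) = M.rk A := by
  have := M.rk_union_of_subset_closure hA (Finset.Subset.refl (M.closure A))
  rwa [Finset.union_eq_right.2 (M.subset_closure hA)] at this

theorem isFlat_inter {F G : Finset α} (hF : M.IsFlat F) (hG : M.IsFlat G) :
    M.IsFlat (F ∩ G) := by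
  have hE : F ∩ G ⊆ M.E := Finset.inter_subset_left.trans hF.1
  have : M.closure (F ∩ G) = F ∩ G := (Finset.subset_inter
    (M.closure_subset_of_isFlat hF Finset.inter_subset_left)
    (M.closure_subset_of_isFlat hG Finset.inter_subset_right)).antisymm (M.subset_closure hE)
  exact this ▸ M.isFlat_closure hE

/-- The lattice structure on the flats. -/
@[reducible] def flatLattice : Lattice M.Flat where
  toPartialOrder := inferInstance
  sup F G := ⟨M.closure (F.1 ∪ G.1), M.isFlat_closure (Finset.union_subset F.2.1 G.2.1)⟩
  le_sup_left F G := Finset.subset_union_left.trans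
    (M.subset_closure (Finset.union_subset F.2.1 G.2.1))
  le_sup_right F G := Finset.subset_union_right.trans
    (M.subset_closure (Finset.union_subset F.2.1 G.2.1))
  sup_le _ _ H h1 h2 := M.closure_subset_of_isFlat H.2 (Finset.union_subset h1 h2)
  inf F G := ⟨F.1 ∩ G.1, M.isFlat_inter F.2 G.2⟩
  inf_le_left _ _ := Finset.inter_subset_left
  inf_le_right _ _ := Finset.inter_subset_right
  le_inf _ _ _ h1 h2 := Finset.subset_inter h1 h2

attribute [local instance] flatLattice

/-- The empty flat of a loopless polymatroid is the least one. -/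
@[reducible] def flatOrderBot (hM : M.Loopless) : OrderBot M.Flat where
  bot := ⟨∅, hM⟩
  bot_le F := Finset.empty_subset F.1

/-- The ground set as a flat. -/
def topFlat : M.Flat := ⟨M.E, Finset.Subset.refl _, fun e he => by simp at he⟩

theorem isRank_flat (hM : M.Loopless) :
    letI := M.flatOrderBot hM
    BuildingSet.IsRank fun F : M.Flat => M.rk F.1 := by
  let := M.flatOrderBot hM
  refine ⟨M.rk_empty, fun F G hFG => ?_, fun F G => ?_⟩
  · obtain ⟨e, heG, heF⟩ := Finset.exists_of_ssubset (show F.1 ⊂ G.1 from hFG)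
    exact (F.2.2 e (Finset.mem_sdiff.2 ⟨G.2.1 heG, heF⟩)).trans_le
      (M.rk_mono _ _ (Finset.insert_subset heG (show F.1 ⊆ G.1 from hFG.le)) G.2.1)
  · have h1 := M.rk_submod F.1 G.1 F.2.1 G.2.1
    rwa [← M.rk_closure (Finset.union_subset F.2.1 G.2.1)] at h1

variable {M} {𝒢 : Finset (Finset α)}

/-- The members of a building set as a family of flats. -/
def IsBuildingSet.emb (h𝒢 : M.IsBuildingSet 𝒢) : {G // G ∈ 𝒢} ↪o M.Flat where
  toFun G := ⟨G.1, h𝒢.isFlat G.1 G.2⟩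
  inj' _ _ h := Subtype.ext (congrArg (fun F : M.Flat => F.1) h)
  map_rel_iff' := Iff.rfl

theorem mem_factors_below {F G : Finset α} :
    G ∈ factors (below 𝒢 F) ↔ G ∈ 𝒢 ∧ G ⊆ F ∧ ∀ H ∈ 𝒢, H ⊆ F → G ⊆ H → H = G := by
  simp only [factors, below, Finset.mem_filter, and_imp, and_assoc]

theorem IsBuildingSet.map_fac (h𝒢 : M.IsBuildingSet 𝒢) (F : M.Flat) :
    (BuildingSet.fac h𝒢.emb F).map (Function.Embedding.subtype _) = factors (below 𝒢 F.1) := by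
  ext G
  rw [mem_factors_below, Finset.mem_map]
  constructor
  · rintro ⟨i, hi, rfl⟩
    obtain ⟨h1, h2⟩ := BuildingSet.mem_fac.1 hi
    exact ⟨i.2, h1, fun H hH hHF hle => congrArg Subtype.val (h2 ⟨H, hH⟩ hHF hle)⟩
  · rintro ⟨hG, hGF, hmax⟩
    exact ⟨⟨G, hG⟩, BuildingSet.mem_fac.2 ⟨hGF, fun H hHF hle =>
      Subtype.ext (hmax H.1 H.2 hHF hle)⟩, rfl⟩

/-- Only surjectivity of the join isomorphism is used: the components of a preimage of `K` lie below
both `K` and the factors. Injectivity is recovered from ranks in `IsBuilding.sup_inf_eq`. -/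
theorem IsBuildingSet.isBuilding (hM : M.Loopless) (h𝒢 : M.IsBuildingSet 𝒢) :
    letI := M.flatOrderBot hM
    BuildingSet.IsBuilding h𝒢.emb (fun F : M.Flat => M.rk F.1) M.topFlat := by
  let := M.flatOrderBot hM
  refine ⟨M.isRank_flat hM, fun i h => ?_, fun F _ K hK => ?_, fun F _ => ?_⟩
  · exact (h𝒢.nonempty i.1 i.2).ne_empty (congrArg (fun F : M.Flat => F.1) h)
  · obtain ⟨φ, hφ⟩ := h𝒢.iso F
    set x := φ.symm ⟨K, hK⟩ with hx
    have h1 : K.1 = M.join Finset.univ fun G => (x G).1.1 := by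
      rw [← hφ x, hx, OrderIso.apply_symm_apply]
    set R := (BuildingSet.fac h𝒢.emb F).sup fun i => K ⊓ h𝒢.emb i with hR
    change K.1 ⊆ R.1
    rw [h1]
    refine M.closure_subset_of_isFlat R.2 (Finset.sup_le fun G _ => ?_)
    obtain ⟨i, hi, hiG⟩ := Finset.mem_map.1 ((h𝒢.map_fac F).ge G.2)
    have h2 : (x G).1 ≤ K := by
      change (x G).1.1 ⊆ K.1
      rw [h1]
      refine Finset.Subset.trans ?_ (M.subset_closure (Finset.sup_le fun G _ => (x G).1.2.1))
      exact Finset.le_sup (f := fun G => (x G).1.1) (Finset.mem_univ G)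
    have h3 : (x G).1 ≤ h𝒢.emb i := by
      change (x G).1.1 ⊆ i.1
      have : i.1 = G.1 := hiG
      rw [this]
      exact (x G).2
    exact (le_inf h2 h3).trans (Finset.le_sup (f := fun i => K ⊓ h𝒢.emb i) hi)
  · rw [h𝒢.rk_eq F, ← h𝒢.map_fac, Finset.sum_map]
    rfl

theorem restrict_closure {G : M.Flat} {A : Finset α} (hA : A ⊆ G.1) :
    (M.restrict G.1 G.2.1).closure A = M.closure A := by
  ext e
  change e ∈ G.1.filter (fun e => M.rk (insert e A) = M.rk A) ↔ e ∈ M.E.filter _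
  rw [Finset.mem_filter, Finset.mem_filter]
  constructor
  · exact fun h => ⟨G.2.1 h.1, h.2⟩
  · intro h
    refine ⟨M.closure_subset_of_isFlat G.2 hA (Finset.mem_filter.2 h), h.2⟩

theorem mem_minorSet {F G : M.Flat} (hFG : F ≤ G) {A : Finset α} : A ∈ M.minorSet 𝒢 F G ↔
    ∃ H ∈ 𝒢, H ⊆ G.1 ∧ ¬ H ⊆ F.1 ∧ M.closure (H ∪ F.1) \ F.1 = A := by
  simp only [minorSet, contractSet, below, Finset.mem_image, Finset.mem_filter]
  constructor
  · rintro ⟨H, ⟨⟨h1, h2⟩, h3⟩, h4⟩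
    rw [restrict_closure (Finset.union_subset h2 hFG)] at h4
    exact ⟨H, h1, h2, h3, h4⟩
  · rintro ⟨H, h1, h2, h3, h4⟩
    refine ⟨H, ⟨⟨h1, h2⟩, h3⟩, ?_⟩
    rwa [restrict_closure (Finset.union_subset h2 hFG)]

theorem closure_sdiff_union {F : M.Flat} {H : Finset α} (hH : H ⊆ M.E) :
    M.closure (H ∪ F.1) \ F.1 ∪ F.1 = M.closure (H ∪ F.1) :=
  Finset.sdiff_union_of_subset (Finset.subset_union_right.trans
    (M.subset_closure (Finset.union_subset hH F.2.1)))

theorem disjoint_of_mem_minorSet {F G : M.Flat} (hFG : F ≤ G) {A : Finset α}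
    (hA : A ∈ M.minorSet 𝒢 F G) : Disjoint A F.1 := by
  obtain ⟨H, _, _, _, rfl⟩ := (mem_minorSet hFG).1 hA
  exact Finset.sdiff_disjoint

theorem isFlat_of_mem_minorSet {F G : M.Flat} (hFG : F ≤ G) {A : Finset α}
    (hA : A ∈ M.minorSet 𝒢 F G) : M.IsFlat (A ∪ F.1) := by
  obtain ⟨H, _, hHG, _, rfl⟩ := (mem_minorSet hFG).1 hA
  have hH := hHG.trans G.2.1
  rw [closure_sdiff_union hH]
  exact M.isFlat_closure (Finset.union_subset hH F.2.1)

/-- The members of `𝒢|_G/F` as flats above `F`. -/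
def minorEmb (M : Polymatroid α) (𝒢 : Finset (Finset α)) {F G : M.Flat} (hFG : F ≤ G) :
    {A // A ∈ M.minorSet 𝒢 F G} ↪o Set.Ici F :=
  OrderEmbedding.ofMapLEIff (fun A => (⟨⟨A.1 ∪ F.1, isFlat_of_mem_minorSet hFG A.2⟩,
    (Finset.subset_union_right : F.1 ⊆ A.1 ∪ F.1)⟩ : Set.Ici F)) fun A B => by
      change A.1 ∪ F.1 ⊆ B.1 ∪ F.1 ↔ A.1 ⊆ B.1
      constructor
      · intro h e he
        rcases Finset.mem_union.1 (h (Finset.mem_union_left _ he)) with h' | h'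
        · exact h'
        · exact absurd h' (Finset.disjoint_left.1 (disjoint_of_mem_minorSet hFG A.2) he)
      · exact Finset.union_subset_union_left

theorem coe_minorEmb {F G : M.Flat} (hFG : F ≤ G) (A : {A // A ∈ M.minorSet 𝒢 F G}) :
    (M.minorEmb 𝒢 hFG A).1.1 = A.1 ∪ F.1 := rfl

theorem minorEmb_le {F G : M.Flat} (hFG : F ≤ G) (A : {A // A ∈ M.minorSet 𝒢 F G}) :
    M.minorEmb 𝒢 hFG A ≤ ⟨G, hFG⟩ := by
  change A.1 ∪ F.1 ⊆ G.1
  obtain ⟨H, _, hHG, _, hA⟩ := (mem_minorSet hFG).1 A.2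
  rw [← hA, closure_sdiff_union (hHG.trans G.2.1)]
  exact M.closure_subset_of_isFlat G.2 (Finset.union_subset hHG hFG)

theorem isContraction_minorEmb (hM : M.Loopless) (h𝒢 : M.IsBuildingSet 𝒢) {F G : M.Flat}
    (hFG : F ≤ G) :
    letI := M.flatOrderBot hM
    BuildingSet.IsContraction h𝒢.emb G (M.minorEmb 𝒢 hFG) := by
  let := M.flatOrderBot hM
  intro x
  constructor
  · rintro ⟨A, rfl⟩
    obtain ⟨H, hH, hHG, hHF, hA⟩ := (mem_minorSet hFG).1 A.2
    refine ⟨⟨H, hH⟩, hHG, hHF, Subtype.ext ?_⟩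
    rw [coe_minorEmb, ← hA, closure_sdiff_union (hHG.trans G.2.1)]
    rfl
  · rintro ⟨H, hHG, hHF, hx⟩
    refine ⟨⟨M.closure (H.1 ∪ F.1) \ F.1, (mem_minorSet hFG).2 ⟨H.1, H.2, hHG, hHF, rfl⟩⟩, ?_⟩
    refine Subtype.ext (Subtype.ext ?_)
    rw [coe_minorEmb, closure_sdiff_union (h𝒢.isFlat H.1 H.2).1, ← hx]
    rfl

/-- The rank function on the flats above `F`. -/
def upRk (M : Polymatroid α) (F : M.Flat) (x : Set.Ici F) : ℕ := M.rk x.1.1 - M.rk F.1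

theorem isBuilding_minorEmb (hM : M.Loopless) (h𝒢 : M.IsBuildingSet 𝒢) {F G : M.Flat}
    (hFG : F ≤ G) : BuildingSet.IsBuilding (M.minorEmb 𝒢 hFG) (M.upRk F) ⟨G, hFG⟩ := by
  let := M.flatOrderBot hM
  exact ((h𝒢.isBuilding hM).mono (show G ≤ M.topFlat from G.2.1)).contract
    (isContraction_minorEmb hM h𝒢 hFG) hFG

theorem facCount_minorEmb (hM : M.Loopless) (h𝒢 : M.IsBuildingSet 𝒢) {F G : M.Flat}
    (hFG : F ≤ G) (H : Set.Ici F) :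
    BuildingSet.facCount (M.minorEmb 𝒢 hFG) H ⟨G, hFG⟩ =
      BuildingSet.facCount h𝒢.emb H.1 G := by
  let := M.flatOrderBot hM
  exact ((h𝒢.isBuilding hM).mono (show G ≤ M.topFlat from G.2.1)).facCount_contract
    (isContraction_minorEmb hM h𝒢 hFG) hFG H

theorem card_factors_minorSet (hM : M.Loopless) (h𝒢 : M.IsBuildingSet 𝒢) {F G : M.Flat}
    (hFG : F ≤ G) :
    (factors (M.minorSet 𝒢 F G)).card = BuildingSet.facCount h𝒢.emb F G := by
  rw [← facCount_minorEmb hM h𝒢 hFG ⟨F, Finset.Subset.refl F.1⟩, BuildingSet.facCount,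
    ← Finset.card_map (Function.Embedding.subtype _)]
  congr 1
  ext A
  simp only [factors, Finset.mem_filter, Finset.mem_map]
  constructor
  · rintro ⟨hA, hmax⟩
    refine ⟨⟨A, hA⟩, ⟨BuildingSet.mem_fac.2 ⟨minorEmb_le hFG _, fun B _ hAB =>
      Subtype.ext (hmax B.1 B.2 hAB)⟩, fun hle => ?_⟩, rfl⟩
    obtain ⟨H, hH, hHG, hHF, rfl⟩ := (mem_minorSet hFG).1 hA
    have h1 : M.closure (H ∪ F.1) \ F.1 ∪ F.1 ⊆ F.1 := hle
    rw [closure_sdiff_union (hHG.trans G.2.1)] at h1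
    exact hHF ((Finset.subset_union_left.trans (M.subset_closure
      (Finset.union_subset (hHG.trans G.2.1) F.2.1))).trans h1)
  · rintro ⟨A, ⟨hA, -⟩, rfl⟩
    exact ⟨A.2, fun B hB hAB => congrArg Subtype.val
      ((BuildingSet.mem_fac.1 hA).2 ⟨B, hB⟩ (minorEmb_le hFG _) hAB)⟩

theorem upRk_sup {F G : M.Flat} (hFG : F ≤ G) (T : Finset {A // A ∈ M.minorSet 𝒢 F G}) :
    M.upRk F (T.sup (M.minorEmb 𝒢 hFG)) = M.rk (T.sup Subtype.val ∪ F.1) - M.rk F.1 := by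
  have hE : T.sup Subtype.val ∪ F.1 ⊆ M.E := Finset.union_subset
    (Finset.sup_le fun A _ => Finset.subset_union_left.trans (isFlat_of_mem_minorSet hFG A.2).1)
    F.2.1
  have h1 : (T.sup (M.minorEmb 𝒢 hFG)).1.1 = M.closure (T.sup Subtype.val ∪ F.1) := by
    apply Finset.Subset.antisymm
    · have hF : F ≤ (⟨_, M.isFlat_closure hE⟩ : M.Flat) :=
        Finset.subset_union_right.trans (M.subset_closure hE)
      have : T.sup (M.minorEmb 𝒢 hFG) ≤ ⟨⟨_, M.isFlat_closure hE⟩, hF⟩ := by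
        refine Finset.sup_le fun A hA => ?_
        change A.1 ∪ F.1 ⊆ _
        refine Finset.Subset.trans (Finset.union_subset_union_left ?_) (M.subset_closure hE)
        exact Finset.le_sup (f := Subtype.val) hA
      exact this
    · refine M.closure_subset_of_isFlat (T.sup (M.minorEmb 𝒢 hFG)).1.2
        (Finset.union_subset (Finset.sup_le fun A hA => ?_) (T.sup (M.minorEmb 𝒢 hFG)).2)
      have h2 : M.minorEmb 𝒢 hFG A ≤ T.sup (M.minorEmb 𝒢 hFG) := Finset.le_sup hA
      exact Finset.subset_union_left.trans (show A.1 ∪ F.1 ⊆ _ from h2)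
  rw [upRk, h1, M.rk_closure hE]

/-- The index types agree, so the ideals live in the same polynomial ring. Only the exponents need
comparison, and there closure in the minor does not change the rank of a union. -/
theorem chowIdeal_minor {F G : M.Flat} (hFG : F ≤ G) :
    (M.minor F G hFG).chowIdeal (M.minorSet 𝒢 F G) =
      BuildingSet.relIdeal (M.minorEmb 𝒢 hFG) (M.upRk F) := by
  have key : ∀ S A, (M.minor F G hFG).chowRelation (M.minorSet 𝒢 F G) S A =
      BuildingSet.relation (M.minorEmb 𝒢 hFG) (M.upRk F) S A := by
    intro S A
    unfold chowRelation BuildingSet.relation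
    congr 2
    · unfold BuildingSet.upVar
      refine Finset.sum_congr ?_ fun _ _ => rfl
      ext B
      simp only [Finset.mem_filter]
      rfl
    · congr 1
      have h1 : (S.filter fun H => H.1 ⊂ A.1).sup Subtype.val ⊆ (M.minor F G hFG).E := by
        refine Finset.sup_le fun B _ e he => Finset.mem_sdiff.2 ⟨?_, ?_⟩
        · exact minorEmb_le hFG B (Finset.mem_union_left _ he)
        · exact Finset.disjoint_left.1 (disjoint_of_mem_minorSet hFG B.2) he
      rw [join, rk_closure _ h1]
      refine (upRk_sup hFG (S.filter fun H => H.1 ⊂ A.1)).symm.trans ?_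
      refine congrArg (fun T => M.upRk F (Finset.sup T (M.minorEmb 𝒢 hFG))) ?_
      ext B
      simp only [Finset.mem_filter]
      rfl
  unfold chowIdeal BuildingSet.relIdeal
  simp_rw [key]

/-- Equal ideals still give distinct quotient types; the statement carries vanishing and dimension
across. -/
theorem map_mk_congr {σ : Type*} {I J : Ideal (MvPolynomial σ ℚ)} (h : I = J)
    (V : Submodule ℚ (MvPolynomial σ ℚ)) :
    (V.map (Ideal.Quotient.mkₐ ℚ I).toLinearMap = ⊥ ↔
      V.map (Ideal.Quotient.mkₐ ℚ J).toLinearMap = ⊥) ∧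
    Module.finrank ℚ (V.map (Ideal.Quotient.mkₐ ℚ I).toLinearMap) =
      Module.finrank ℚ (V.map (Ideal.Quotient.mkₐ ℚ J).toLinearMap) := by
  subst h
  exact ⟨Iff.rfl, rfl⟩

theorem chowPiece_minor_eq_bot (hM : M.Loopless) (h𝒢 : M.IsBuildingSet 𝒢) {F G : M.Flat}
    (hFG : F < G) {i : ℕ} (hi : (M.minor F G hFG.le).rk (M.minor F G hFG.le).E ≤ i) :
    (M.minor F G hFG.le).chowPiece (M.minorSet 𝒢 F G) i = ⊥ := by
  have h1 := (isBuilding_minorEmb hM h𝒢 hFG.le).relPiece_eq_bot (minorEmb_le hFG.le)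
    (fun h => hFG.ne (congrArg Subtype.val h).symm) (n := i) ?_
  · exact (map_mk_congr (chowIdeal_minor hFG.le) _).1.2 h1
  · refine le_of_eq_of_le ?_ hi
    change M.rk G.1 - M.rk F.1 = M.rk (G.1 \ F.1 ∪ F.1) - M.rk F.1
    rw [Finset.sdiff_union_of_subset hFG.le]

end Flats

end Polymatroid

/-- `Finset.mem_filter` for an arbitrary decidability witness. -/
theorem Finset.mem_filter_of_decidablePred {ι : Type*} {p : ι → Prop} {d : DecidablePred p}
    {s : Finset ι} {a : ι} : a ∈ @Finset.filter ι p d s ↔ a ∈ s ∧ p a :=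
  Finset.mem_filter

namespace Polymatroid

/-! ### Characteristic polynomials of minors and the inverse in the incidence algebra -/

section Minors

open Polynomial

variable {α : Type*} [DecidableEq α] {M : Polymatroid α} {𝒢 : Finset (Finset α)}

attribute [local instance] flatLattice

theorem isFlat_minor_iff {F G : M.Flat} (hFG : F ≤ G) {A : Finset α} (hA : A ⊆ G.1 \ F.1) :
    (M.minor F G hFG).IsFlat A ↔ M.IsFlat (A ∪ F.1) := by
  have hAG : A ∪ F.1 ⊆ G.1 := Finset.union_subset (hA.trans Finset.sdiff_subset) hFG
  have hAE := hAG.trans G.2.1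
  have hrk : M.rk F.1 ≤ M.rk (A ∪ F.1) := M.rk_mono _ _ Finset.subset_union_right hAE
  constructor
  · intro h
    refine ⟨hAE, fun e he => ?_⟩
    obtain ⟨heE, heA⟩ := Finset.mem_sdiff.1 he
    by_cases heG : e ∈ G.1
    · have h1 : M.rk (A ∪ F.1) - M.rk F.1 < M.rk (insert e A ∪ F.1) - M.rk F.1 := by
        refine h.2 e (Finset.mem_sdiff.2 ⟨Finset.mem_sdiff.2 ⟨heG, fun h' => heA ?_⟩,
          fun h' => heA ?_⟩)
        · exact Finset.mem_union_right _ h'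
        · exact Finset.mem_union_left _ h'
      rw [Finset.insert_union] at h1
      omega
    -- An element outside `G` is invisible to the minor, but it raises the rank because `G` is a
    -- flat containing `A ∪ F`.
    · refine lt_of_le_of_ne (M.rk_mono _ _ (Finset.subset_insert _ _)
        (Finset.insert_subset heE hAE)) fun h' => heG ?_
      exact M.closure_subset_of_isFlat G.2 hAG (Finset.mem_filter.2 ⟨heE, h'.symm⟩)
  · intro h
    refine ⟨hA, fun e he => ?_⟩
    obtain ⟨heE, heA⟩ := Finset.mem_sdiff.1 he
    obtain ⟨heG, heF⟩ := Finset.mem_sdiff.1 (show e ∈ G.1 \ F.1 from heE)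
    have h1 := h.2 e (Finset.mem_sdiff.2 ⟨G.2.1 heG, fun h' =>
      (Finset.mem_union.1 h').elim heA heF⟩)
    change M.rk (A ∪ F.1) - M.rk F.1 < M.rk (insert e A ∪ F.1) - M.rk F.1
    rw [Finset.insert_union]
    omega

/-- The flats of a minor as flats of `M`. -/
def minorFlatEmb {F G : M.Flat} (hFG : F ≤ G) : (M.minor F G hFG).Flat ↪o M.Flat :=
  OrderEmbedding.ofMapLEIff (fun A => ⟨A.1 ∪ F.1, (isFlat_minor_iff hFG A.2.1).1 A.2⟩)
    fun A B => by
      change A.1 ∪ F.1 ⊆ B.1 ∪ F.1 ↔ A.1 ⊆ B.1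
      constructor
      · intro h e he
        rcases Finset.mem_union.1 (h (Finset.mem_union_left _ he)) with h' | h'
        · exact h'
        · exact absurd h' (Finset.mem_sdiff.1 (show e ∈ G.1 \ F.1 from A.2.1 he)).2
      · exact Finset.union_subset_union_left

theorem exists_minorFlatEmb_eq {F G : M.Flat} (hFG : F ≤ G) {H : M.Flat} (hFH : F ≤ H)
    (hHG : H ≤ G) : ∃ A, minorFlatEmb hFG A = H := by
  have h1 : H.1 \ F.1 ∪ F.1 = H.1 := Finset.sdiff_union_of_subset hFH
  exact ⟨⟨H.1 \ F.1, (isFlat_minor_iff hFG (Finset.sdiff_subset_sdiff hHG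
    (Finset.Subset.refl _))).2 (h1.symm ▸ H.2)⟩, Subtype.ext h1⟩

theorem le_minorFlatEmb {F G : M.Flat} (hFG : F ≤ G) (A : (M.minor F G hFG).Flat) :
    F ≤ minorFlatEmb hFG A :=
  show F.1 ⊆ A.1 ∪ F.1 from Finset.subset_union_right

theorem minorFlatEmb_le {F G : M.Flat} (hFG : F ≤ G) (A : (M.minor F G hFG).Flat) :
    minorFlatEmb hFG A ≤ G :=
  show A.1 ∪ F.1 ⊆ G.1 from
    Finset.union_subset (Finset.Subset.trans A.2.1 Finset.sdiff_subset) hFG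

theorem minorFlatEmb_botFlat {F G : M.Flat} (hFG : F ≤ G) :
    minorFlatEmb hFG (M.minor F G hFG).botFlat = F := by
  obtain ⟨A, hA⟩ := exists_minorFlatEmb_eq hFG le_rfl hFG
  have h : (M.minor F G hFG).botFlat ≤ A :=
    (M.minor F G hFG).closure_subset_of_isFlat A.2 (Finset.empty_subset _)
  exact le_antisymm (((minorFlatEmb hFG).le_iff_le.2 h).trans hA.le) (le_minorFlatEmb _ _)

theorem rk_minor_ground {F G : M.Flat} (hFG : F ≤ G) :
    (M.minor F G hFG).rk (M.minor F G hFG).E = M.rk G.1 - M.rk F.1 := by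
  change M.rk (G.1 \ F.1 ∪ F.1) - M.rk F.1 = _
  rw [Finset.sdiff_union_of_subset hFG]

/-- The characteristic polynomial of an interval of flats. -/
noncomputable def chiFlat (F G : M.Flat) : ℤ[X] :=
  ∑ H ∈ Finset.Icc F G, monomial (M.rk G.1 - M.rk H.1) (IncidenceAlgebra.mu ℤ F H)

theorem charPoly_minor {F G : M.Flat} (hFG : F ≤ G) :
    (M.minor F G hFG).charPoly = chiFlat F G := by
  unfold charPoly chiFlat
  refine Finset.sum_bij (fun A _ => minorFlatEmb hFG A) ?_ ?_ ?_ ?_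
  · exact fun A _ => Finset.mem_Icc.2 ⟨le_minorFlatEmb hFG A, minorFlatEmb_le hFG A⟩
  · exact fun A _ B _ h => (minorFlatEmb hFG).injective h
  · intro H hH
    obtain ⟨h1, h2⟩ := Finset.mem_Icc.1 hH
    obtain ⟨A, hA⟩ := exists_minorFlatEmb_eq hFG h1 h2
    exact ⟨A, Finset.mem_univ _, hA⟩
  · intro A _
    have h1 := IncidenceAlgebra.mu_apply_of_orderEmbedding (R := ℤ) (minorFlatEmb hFG)
      (fun x y q hx hy => exists_minorFlatEmb_eq hFG ((le_minorFlatEmb hFG x).trans hx)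
        (hy.trans (minorFlatEmb_le hFG y))) (M.minor F G hFG).botFlat A
    rw [minorFlatEmb_botFlat] at h1
    rw [← h1, rk_minor_ground]
    congr 2
    change M.rk G.1 - M.rk F.1 - (M.rk (A.1 ∪ F.1) - M.rk F.1) = M.rk G.1 - M.rk (A.1 ∪ F.1)
    have h2 : M.rk F.1 ≤ M.rk (A.1 ∪ F.1) :=
      M.rk_mono _ _ (le_minorFlatEmb hFG A) (minorFlatEmb hFG A).2.1
    omega

/-- After exchanging the sums, the Möbius values over each inner interval cancel unless its top is
`K`. -/
theorem sum_chiFlat {K G : M.Flat} (hKG : K ≤ G) :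
    ∑ H ∈ Finset.Icc K G, chiFlat H G = X ^ (M.rk G.1 - M.rk K.1) := by
  unfold chiFlat
  rw [Finset.sum_comm' (t' := Finset.Icc K G) (s' := fun J => Finset.Icc K J)]
  · simp_rw [← map_sum, IncidenceAlgebra.sum_Icc_mu_left]
    rw [Finset.sum_eq_single K]
    · rw [if_pos rfl, monomial_one_right_eq_X_pow]
    · intro J _ hJ
      rw [if_neg hJ.symm, map_zero]
    · exact fun h => absurd (Finset.mem_Icc.2 ⟨le_rfl, hKG⟩) h
  · intro H J
    simp only [Finset.mem_Icc]
    constructor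
    · rintro ⟨⟨h1, h2⟩, h3, h4⟩
      exact ⟨⟨h1, h3⟩, h1.trans h3, h4⟩
    · rintro ⟨⟨h1, h2⟩, h3, h4⟩
      exact ⟨⟨h1, h2.trans h4⟩, h2, h4⟩

theorem isCharFun_chiFlat (F : M.Flat) [Fintype (Set.Ici F)] :
    BuildingSet.IsCharFun (M.upRk F) fun K G => chiFlat K.1 G.1 := by
  intro K G hKG
  have h1 : M.rk F.1 ≤ M.rk K.1.1 := M.rk_mono _ _ K.2 K.1.2.1
  have h2 : M.upRk F G - M.upRk F K = M.rk G.1.1 - M.rk K.1.1 := by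
    unfold upRk
    omega
  rw [h2, ← sum_chiFlat (show K.1 ≤ G.1 from hKG)]
  refine Finset.sum_bij (fun H _ => H.1) ?_ ?_ ?_ ?_
  · intro H hH
    rw [Finset.mem_filter_of_decidablePred] at hH
    exact Finset.mem_Icc.2 hH.2
  · exact fun H _ H' _ h => Subtype.ext h
  · intro H hH
    obtain ⟨h1, h2⟩ := Finset.mem_Icc.1 hH
    refine ⟨⟨H, le_trans K.2 h1⟩, ?_, rfl⟩
    rw [Finset.mem_filter_of_decidablePred]
    exact ⟨Finset.mem_univ _, h1, h2⟩
  · exact fun _ _ => rfl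

theorem pow_facCount_dvd_chiFlat (hM : M.Loopless) (h𝒢 : M.IsBuildingSet 𝒢) {F G : M.Flat}
    (hFG : F ≤ G) : (1 - X) ^ BuildingSet.facCount h𝒢.emb F G ∣ chiFlat F G := by
  let : Fintype (Set.Ici F) := Fintype.ofFinite _
  have h1 := (isBuilding_minorEmb hM h𝒢 hFG).pow_dvd_chi (isCharFun_chiFlat F)
    (F := ⟨F, Finset.Subset.refl F.1⟩) hFG
  rwa [facCount_minorEmb hM h𝒢] at h1

theorem minor_ground_ne_empty {F G : M.Flat} (hFG : F < G) : (M.minor F G hFG.le).E ≠ ∅ :=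
  fun h => hFG.not_ge (Finset.sdiff_eq_empty_iff_subset.1 (show G.1 \ F.1 = ∅ from h))

theorem pow_mul_reducedCharFun (hM : M.Loopless) (h𝒢 : M.IsBuildingSet 𝒢) {F G : M.Flat}
    (hFG : F < G) : (1 - X) ^ BuildingSet.facCount h𝒢.emb F G * M.reducedCharFun 𝒢 F G =
      -chiFlat F G := by
  have h1 : M.reducedCharFun 𝒢 F G =
      (M.minor F G hFG.le).reducedCharPoly (M.minorSet 𝒢 F G) := dif_pos hFG
  rw [h1, reducedCharPoly, if_neg (minor_ground_ne_empty hFG), charPoly_minor,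
    card_factors_minorSet hM h𝒢 hFG.le]
  set k := BuildingSet.facCount h𝒢.emb F G with hk
  have h2 : (1 - X : ℤ[X]) ^ k = (-1) ^ k * (X - 1) ^ k := by
    rw [← mul_pow]
    ring
  have h3 : (X - 1 : ℤ[X]) ^ k ∣ chiFlat F G := by
    have := pow_facCount_dvd_chiFlat hM h𝒢 hFG.le
    rw [← hk, h2] at this
    exact dvd_of_mul_left_dvd this
  have hmonic : ((X - 1 : ℤ[X]) ^ k).Monic := by
    have : (X - 1 : ℤ[X]) = X - C 1 := by simp
    rw [this]
    exact (monic_X_sub_C _).pow k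
  obtain ⟨q, hq⟩ := h3
  have h4 : ((-1 : ℤ[X]) ^ k) * (-1) ^ k = 1 := by
    rw [← mul_pow]
    simp
  rw [h2, hq, mul_divByMonic_cancel_left _ hmonic]
  linear_combination (-(X - 1) ^ k * q) * h4

theorem chowPoly_minor (hM : M.Loopless) (h𝒢 : M.IsBuildingSet 𝒢) {F G : M.Flat}
    (hFG : F < G) : (M.minor F G hFG.le).chowPoly (M.minorSet 𝒢 F G) =
      ∑ a ∈ BuildingSet.stdSet (M.minorEmb 𝒢 hFG.le) (M.upRk F), X ^ ∑ i, a i := by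
  have hB := isBuilding_minorEmb hM h𝒢 hFG.le
  have hle := minorEmb_le (𝒢 := 𝒢) hFG.le
  have hlt : ∀ a ∈ BuildingSet.stdSet (M.minorEmb 𝒢 hFG.le) (M.upRk F),
      ∑ i, a i ∈ Finset.range (M.rk G.1 - M.rk F.1) := fun a ha =>
    Finset.mem_range.2 (hB.sum_lt_of_isStd hle (fun h => hFG.ne (congrArg Subtype.val h).symm)
      (BuildingSet.mem_stdSet.1 ha))
  rw [chowPoly, if_neg (minor_ground_ne_empty hFG), rk_minor_ground,
    ← Finset.sum_fiberwise_of_maps_to hlt]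
  refine Finset.sum_congr rfl fun i _ => ?_
  have h1 : Module.finrank ℚ ((M.minor F G hFG.le).chowPiece (M.minorSet 𝒢 F G) i) =
      Module.finrank ℚ (BuildingSet.relPiece (M.minorEmb 𝒢 hFG.le) (M.upRk F) i) :=
    (map_mk_congr (chowIdeal_minor hFG.le) _).2
  rw [h1, hB.finrank_relPiece hle]
  have h2 : ∀ a ∈ (BuildingSet.stdSet (M.minorEmb 𝒢 hFG.le) (M.upRk F)).filter
      (fun a => ∑ i, a i = i), (X : ℤ[X]) ^ ∑ i, a i = X ^ i := fun a ha => by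
    rw [(Finset.mem_filter.1 ha).2]
  rw [Finset.sum_congr rfl h2, Finset.sum_const, ← C_mul_X_pow_eq_monomial, nsmul_eq_mul]
  congr 1

/-- The entries of row `F` come from different minors. Each is the restriction of the single family
of the minor on `[F, G]` to the members below `H`, which makes the abstract convolution identity
applicable. -/
theorem chowFun_eq (hM : M.Loopless) (h𝒢 : M.IsBuildingSet 𝒢) {F G : M.Flat} (hFG : F ≤ G)
    (H : Set.Ici F) (hHG : H.1 ≤ G) : M.chowFun 𝒢 F H.1 =
      BuildingSet.stdSeries (M.minorEmb 𝒢 hFG) (M.upRk F) H := by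
  have hB := isBuilding_minorEmb hM h𝒢 hFG
  rcases (show F ≤ H.1 from H.2).eq_or_lt with h | h
  · have h1 : H = ⊥ := Subtype.ext h.symm
    rw [h1, hB.stdSeries_bot]
    change M.chowFun 𝒢 F F = 1
    exact (dif_neg (lt_irrefl F)).trans (if_pos rfl)
  · have h1 : M.chowFun 𝒢 F H.1 = (M.minor F H.1 h.le).chowPoly (M.minorSet 𝒢 F H.1) :=
      dif_pos h
    have hsub : ∀ A ∈ M.minorSet 𝒢 F H.1, A ∈ M.minorSet 𝒢 F G := fun A hA => by
      obtain ⟨K, hK, hKH, hKF, hA⟩ := (mem_minorSet h.le).1 hA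
      exact (mem_minorSet hFG).2 ⟨K, hK, hKH.trans hHG, hKF, hA⟩
    rw [h1, chowPoly_minor hM h𝒢 h]
    refine BuildingSet.sum_stdSet_restrict (j := fun A => ⟨A.1, hsub A.1 A.2⟩) hB.toIsRank
      (fun A => rfl) fun A => ?_
    constructor
    · intro hA
      obtain ⟨K, hK, hKG, hKF, hAK⟩ := (mem_minorSet hFG).1 A.2
      have h2 : A.1 ∪ F.1 ⊆ H.1.1 := hA
      rw [← hAK, closure_sdiff_union (hKG.trans G.2.1)] at h2
      have h3 : K ⊆ H.1.1 := (Finset.subset_union_left.trans (M.subset_closure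
        (Finset.union_subset (hKG.trans G.2.1) F.2.1))).trans h2
      exact ⟨⟨A.1, (mem_minorSet h.le).2 ⟨K, hK, h3, hKF, hAK⟩⟩, rfl⟩
    · rintro ⟨B, rfl⟩
      exact minorEmb_le h.le B

theorem reducedCharFun_self (F : M.Flat) : M.reducedCharFun 𝒢 F F = -1 :=
  (dif_neg (lt_irrefl F)).trans (if_pos rfl)

/-- The abstract identity is applied with the negated reduced characteristic function. The sign
makes its value at the top of the interval equal to one, as `chi` requires. -/
theorem sum_chowFun_mul_reducedCharFun (hM : M.Loopless) (h𝒢 : M.IsBuildingSet 𝒢)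
    {F G : M.Flat} (hFG : F < G) :
    ∑ H ∈ Finset.Icc F G, M.chowFun 𝒢 F H * M.reducedCharFun 𝒢 H G = 0 := by
  let : Fintype (Set.Ici F) := Fintype.ofFinite _
  have h1 := (isBuilding_minorEmb hM h𝒢 hFG.le).sum_stdSeries_mul_eq_zero (minorEmb_le hFG.le)
    (fun h => hFG.ne (congrArg Subtype.val h).symm) (isCharFun_chiFlat F)
    (c := fun K => -M.reducedCharFun 𝒢 K.1 G) fun K hK => ?_
  · rw [← neg_eq_zero, ← h1, ← Finset.sum_neg_distrib]
    symm
    refine Finset.sum_bij (fun H _ => H.1) ?_ ?_ ?_ ?_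
    · intro H hH
      rw [Finset.mem_filter_of_decidablePred] at hH
      exact Finset.mem_Icc.2 ⟨H.2, hH.2⟩
    · exact fun H _ H' _ h => Subtype.ext h
    · intro H hH
      obtain ⟨h1, h2⟩ := Finset.mem_Icc.1 hH
      refine ⟨⟨H, h1⟩, ?_, rfl⟩
      rw [Finset.mem_filter_of_decidablePred]
      exact ⟨Finset.mem_univ _, h2⟩
    · intro H hH
      rw [Finset.mem_filter_of_decidablePred] at hH
      rw [chowFun_eq hM h𝒢 hFG.le H hH.2, mul_neg]
  · rw [facCount_minorEmb hM h𝒢, mul_neg]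
    rcases (show K.1 ≤ G from hK).eq_or_lt with h | h
    · have h2 : BuildingSet.facCount h𝒢.emb K.1 G = 0 := by
        rw [BuildingSet.facCount, Finset.card_eq_zero]
        refine Finset.eq_empty_of_forall_notMem fun i hi => ?_
        rw [Finset.mem_filter_of_decidablePred] at hi
        exact hi.2 (h.symm ▸ (BuildingSet.mem_fac.1 hi.1).1)
      rw [h2, h, reducedCharFun_self, pow_zero, one_mul, neg_neg]
      have h3 := (isCharFun_chiFlat F).self ⟨G, hFG.le⟩
      exact h3.symm
    · rw [pow_mul_reducedCharFun hM h𝒢 h, neg_neg]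

theorem neg_chowFun_mul_reducedCharFun (hM : M.Loopless) (h𝒢 : M.IsBuildingSet 𝒢) :
    -M.chowFun 𝒢 * M.reducedCharFun 𝒢 = 1 := by
  ext F G hFG
  have h0 : ∀ H, (-M.chowFun 𝒢) F H = -M.chowFun 𝒢 F H := fun H =>
    IncidenceAlgebra.neg_apply _ _ _
  simp_rw [IncidenceAlgebra.mul_apply, h0, neg_mul, Finset.sum_neg_distrib]
  rcases hFG.eq_or_lt with rfl | h
  · have h1 : M.chowFun 𝒢 F F = 1 := (dif_neg (lt_irrefl F)).trans (if_pos rfl)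
    rw [Finset.Icc_self, Finset.sum_singleton, h1, reducedCharFun_self,
      IncidenceAlgebra.one_apply, if_pos rfl, one_mul, neg_neg]
  · rw [sum_chowFun_mul_reducedCharFun hM h𝒢 h, IncidenceAlgebra.one_apply, if_neg h.ne, neg_zero]

end Minors

end Polymatroid

theorem theorem3p4 {α : Type*} [DecidableEq α] (M : Polymatroid α) (hM : M.Loopless)
    (𝒢 : Finset (Finset α)) (h𝒢 : M.IsBuildingSet 𝒢) :
    -- the quotients defining the reduced characteristic polynomials are exact
    (∀ (F G : M.Flat) (h : F < G),
      (1 - Polynomial.X) ^ (Polymatroid.factors (M.minorSet 𝒢 F G)).card *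
          M.reducedCharFun 𝒢 F G = -(M.minor F G h.le).charPoly) ∧
    -- the Chow rings vanish in degrees at least the rank, so `chowPoly` is the whole Hilbert series
    (∀ (F G : M.Flat) (h : F < G) (i : ℕ),
      (M.minor F G h.le).rk (M.minor F G h.le).E ≤ i →
        (M.minor F G h.le).chowPiece (M.minorSet 𝒢 F G) i = ⊥) ∧
    -- the reduced characteristic function is invertible, with inverse `-H`
    ∃ u : (IncidenceAlgebra (Polynomial ℤ) M.Flat)ˣ,
      (u : IncidenceAlgebra (Polynomial ℤ) M.Flat) = M.reducedCharFun 𝒢 ∧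
        M.chowFun 𝒢 = -((u⁻¹ : (IncidenceAlgebra (Polynomial ℤ) M.Flat)ˣ) :
          IncidenceAlgebra (Polynomial ℤ) M.Flat) := by
  refine ⟨fun F G h => ?_, fun F G h i hi => ?_, ?_⟩
  · rw [Polymatroid.card_factors_minorSet hM h𝒢 h.le,
      Polymatroid.pow_mul_reducedCharFun hM h𝒢 h, Polymatroid.charPoly_minor]
  · exact Polymatroid.chowPiece_minor_eq_bot hM h𝒢 h hi
  · have h1 := Polymatroid.neg_chowFun_mul_reducedCharFun hM h𝒢
    exact ⟨⟨M.reducedCharFun 𝒢, -M.chowFun 𝒢,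
      IncidenceAlgebra.mul_eq_one_comm_of_finite h1, h1⟩, rfl, (neg_neg _).symm⟩
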